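/- Let $T=(V,E)$ be any finite tree whose leaves (nodes of degree one) are identified with $[n]=\{1,\dots,n\}$, let $r\in V$ be any root, and direct the edges of $T$ away from $r$. Let $T^*=(V^*,E^*)$ be a trivalent expansion of $T$: a finite tree whose inner nodes all have degree at most three, together with a set $E'$ of inner edges of $T^*$ (edges joining two non-leaf nodes) such that $T=T^*/E'$ is obtained by contracting the edges in $E'$; the leaves of $T^*$ are identified with those of $T$, hence with $[n]$. *The model.* $\mathcal M_T$ is the set of all probability distributions on $\{0,1\}^n$ of $X=(Y_i)_{i\in[n]}$, where $Y=(Y_v)_{v\in V}$ is a binary random vector satisfying the global Markov properties on $T$, that is, $Y_A\perp\!\!\!\perp Y_B\mid Y_C$ for all disjoint $A,B,C\subseteq V$ such that every path from $A$ to $B$ in $T$ meets $C$. *Tree cumulants of $T^*$.* For a distribution of $X$ put $\lambda_i=\mathbb E X_i$ and $\mu_I=\mathbb E\prod_{i\in I}(X_i-\lambda_i)$ for $I\subseteq[n]$. For $|I|\ge 2$ let $\Pi_{T^*(I)}$ be the poset, ordered by refinement, of the partitions of $I$ induced by the connected components of $T^*(I)\setminus F$ for sets $F$ of edges of $T^*(I)$,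 where $T^*(I)$ is the minimal subtree of $T^*$ containing $I$. Let $\mathfrak m_I$ be its Möbius function, $\hat 1_I$ its maximal element, and $$\kappa^*_I=\sum_{\pi\in\Pi_{T^*(I)}}\mathfrak m_I(\pi,\hat 1_I)\prod_{B\in\pi}\mu_B .$$ Let $\mathcal K_{T^*}$ be the set of all vectors $\big((\lambda_i)_{i\in[n]},(\kappa^*_I)_{I\subseteq[n],\,|I|\ge2}\big)$ obtained from arbitrary probability distributions on $\{0,1\}^n$, and let $\mathcal M_T^\kappa\subseteq\mathcal K_{T^*}$ be the set of those obtained from distributions in $\mathcal M_T$. *Parameters.* Let $\Theta_T=[0,1]^{2|E|+1}$ be the space of parameters $\theta^{(r)}_1$ and $\theta^{(v)}_{1|0},\theta^{(v)}_{1|1}$ for $(u,v)\in E$, put $\theta^{(r)}_0=1-\theta^{(r)}_1$ and $\theta^{(v)}_{0|a}=1-\theta^{(v)}_{1|a}$, and let $Y$ have the distribution $p_\alpha(\theta)=\theta^{(r)}_{\alpha_r}\prod_{(u,v)\in E}\theta^{(v)}_{\alpha_v|\alpha_u}$, $\alpha\in\{0,1\}^V$. Let $\Omega_T\subseteq\mathbb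 R^{|V|+|E|}$ be the image of $\Theta_T$ under the map $\theta\mapsto\big((\bar\mu_v)_{v\in V},(\eta_{u,v})_{(u,v)\in E}\big)$ with $\bar\mu_v=1-2\,\mathbb E Y_v$ and $\eta_{u,v}=\theta^{(v)}_{1|1}-\theta^{(v)}_{1|0}$. **Lemma.** $\mathcal M_T^\kappa$ is contained in $\mathcal K_{T^*}$ and is the image of $\Omega_T$ under the map given by $\lambda_i=\tfrac12(1-\bar\mu_i)$ for $i\in[n]$ (the identity on the coordinates $\bar\mu_i=1-2\lambda_i$) and, for each $I\subseteq[n]$ with $|I|\ge2$, $$\kappa^*_I=\tfrac14\big(1-\bar\mu_{r(I)}^2\big)\prod_{v\in V(I)\setminus I}\bar\mu_v^{\deg(v)-2}\prod_{(u,v)\in E(I)}\eta_{u,v},$$ where $T(I)=(V(I),E(I))$ is the minimal subtree of $T$ containing $I$, the degree $\deg(v)$ is taken in $T(I)$, and $r(I)$ is the root of $T(I)$, that is, its unique node with no parent in $V(I)$. (Here $0^0=1$.) -/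

import Mathlib

namespace TreeCumulants

/-! ### Trees with labelled leaves -/

/-- The degree of a node of a graph: the number of its neighbours. -/
noncomputable def deg {V : Type*} (G : SimpleGraph V) (v : V) : ℕ := (G.neighborSet v).ncard

/-- A tree with node set `V` whose leaves (the nodes of degree one) are identified with the labels
`Fin n`. All other nodes are inner nodes. -/
structure LeafTree (n : ℕ) (V : Type*) where
  graph : SimpleGraph V
  isTree : graph.IsTree
  leaf : Fin n → V
  leaf_injective : Function.Injective leaf
  range_leaf : Set.range leaf = {v | deg graph v = 1}

/-- The minimal subtree `T(W)` spanned on a set `W` of nodes: the smallest connected subgraph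
that contains `W`. -/
def spanned {V : Type*} (G : SimpleGraph V) (W : Set V) : G.Subgraph :=
  sInf {H : G.Subgraph | W ⊆ H.verts ∧ H.Connected}

namespace LeafTree

variable {n : ℕ} {V : Type*}

/-- `T(I)` for a set `I` of leaf labels. -/
def sub (T : LeafTree n V) (I : Finset (Fin n)) : T.graph.Subgraph :=
  spanned T.graph (T.leaf '' (I : Set (Fin n)))

/-- `(u, v)` is an edge of the rooted tree `T^r`, in which all edges are directed away
from `r`; that is, `u` is the parent of `v`. -/
def IsEdge (T : LeafTree n V) (r u v : V) : Prop :=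
  T.graph.Adj u v ∧ T.graph.dist r v = T.graph.dist r u + 1

/-- The set of directed edges of the rooted tree `T^r`. -/
abbrev Edge (T : LeafTree n V) (r : V) : Type _ := {e : V × V // T.IsEdge r e.1 e.2}

end LeafTree

/-! ### Contractions and trivalent expansions -/

/-- The graph `G / E'` obtained by contracting the edges in `E'`. Its nodes are the classes of
nodes of `G` that are joined by paths of edges from `E'`; two distinct classes are adjacent when
some edge of `G` joins them. -/
def contract {V : Type*} (G : SimpleGraph V) (E' : Set (Sym2 V)) :
    SimpleGraph (SimpleGraph.fromEdgeSet E').ConnectedComponent where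
  Adj a b := a ≠ b ∧ ∃ u v : V, (SimpleGraph.fromEdgeSet E').connectedComponentMk u = a ∧
    (SimpleGraph.fromEdgeSet E').connectedComponentMk v = b ∧ G.Adj u v
  symm := ⟨fun _ _ h => ⟨h.1.symm, by
    obtain ⟨u, v, hu, hv, huv⟩ := h.2
    exact ⟨v, u, hv, hu, huv.symm⟩⟩⟩
  loopless := ⟨fun _ h => h.1 rfl⟩

/-- `T'` is a trivalent expansion of `T`: every inner node of `T'` has degree at most three, and
`T` is (identified with) the tree `T' / E'` for a set `E'` of inner edges of `T'`.
The identification matches the leaf labels. -/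
structure TrivalentExpansion {n : ℕ} {V V' : Type*} (T : LeafTree n V) (T' : LeafTree n V') where
  E' : Set (Sym2 V')
  E'_subset : E' ⊆ T'.graph.edgeSet
  E'_inner : ∀ e ∈ E', ∀ v ∈ e, deg T'.graph v ≠ 1
  deg_le_three : ∀ v, deg T'.graph v ≠ 1 → deg T'.graph v ≤ 3
  iso : contract T'.graph E' ≃g T.graph
  iso_leaf : ∀ i, iso ((SimpleGraph.fromEdgeSet E').connectedComponentMk (T'.leaf i)) = T.leaf i

/-! ### The model given by the global Markov properties -/

section Model

variable {V : Type*} [Fintype V]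

/-- `C` separates `A` and `B` in `G`: each path from `A` to `B` passes through `C`. -/
def Separates (G : SimpleGraph V) (A B C : Finset V) : Prop :=
  ∀ a ∈ A, ∀ b ∈ B, ∀ w : G.Walk a b, ∃ c ∈ C, c ∈ w.support

open Classical in
/-- `P(Y_S = y_S)` for a binary random vector `Y` with mass function `p`. -/
noncomputable def margProb (p : (V → Fin 2) → ℝ) (S : Finset V) (y : V → Fin 2) : ℝ :=
  ∑ z : V → Fin 2 with ∀ v ∈ S, z v = y v, p z

open Classical in
/-- Conditional independence of `Y_A` and `Y_B` given `Y_C`, for a mass function `p`: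
`P(Y_A, Y_B, Y_C) P(Y_C) = P(Y_A, Y_C) P(Y_B, Y_C)` for all values. -/
def CondIndep (p : (V → Fin 2) → ℝ) (A B C : Finset V) : Prop :=
  ∀ y : V → Fin 2, margProb p (A ∪ B ∪ C) y * margProb p C y =
    margProb p (A ∪ C) y * margProb p (B ∪ C) y

open Classical in
/-- The distributions of `Y = (Y_v)` that satisfy the global Markov properties on `G`. -/
def markovModel (G : SimpleGraph V) : Set ((V → Fin 2) → ℝ) :=
  {p | p ∈ stdSimplex ℝ (V → Fin 2) ∧ ∀ A B C : Finset V, Disjoint A B → Disjoint A C →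
    Disjoint B C → Separates G A B C → CondIndep p A B C}

open Classical in
/-- The marginal mass function of the leaf variables `X_i = Y_{leaf i}`. -/
noncomputable def leafMarginal {n : ℕ} (T : LeafTree n V) (p : (V → Fin 2) → ℝ) :
    (Fin n → Fin 2) → ℝ :=
  fun x => ∑ y : V → Fin 2 with ∀ i, y (T.leaf i) = x i, p y

/-- The model `M_T`: all distributions of the leaf variables induced by distributions
that satisfy the global Markov properties on `T`. -/
noncomputable def model {n : ℕ} (T : LeafTree n V) : Set ((Fin n → Fin 2) → ℝ) :=
  leafMarginal T '' markovModel T.graph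

end Model

/-! ### Means, central moments -/

/-- The mean `λ_v` of the coordinate `v` of a binary vector with mass function `p`. -/
noncomputable def mean {ι : Type*} [Fintype ι] [DecidableEq ι] (p : (ι → Fin 2) → ℝ) (v : ι) : ℝ :=
  ∑ x, p x * ((x v : ℕ) : ℝ)

/-- The central moment `μ_I = E ∏_{i ∈ I} (X_i - λ_i)`. -/
noncomputable def centralMoment {n : ℕ} (p : (Fin n → Fin 2) → ℝ) (I : Finset (Fin n)) : ℝ :=
  ∑ x, p x * ∏ i ∈ I, (((x i : ℕ) : ℝ) - mean p i)

/-- The change of coordinates from probabilities to means and central moments. -/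
noncomputable def fpμ {n : ℕ} (p : (Fin n → Fin 2) → ℝ) :
    (Fin n → ℝ) × (Finset (Fin n) → ℝ) :=
  (mean p, centralMoment p)

/-- The space `C_n` of all means and central moments of binary vectors of length `n`. -/
noncomputable def momentSpace (n : ℕ) : Set ((Fin n → ℝ) × (Finset (Fin n) → ℝ)) :=
  fpμ '' stdSimplex ℝ (Fin n → Fin 2)

/-! ### Edge partitions and tree cumulants -/

/-- The sets of at least two leaf labels. -/
abbrev BigSet (n : ℕ) : Type := {I : Finset (Fin n) // 2 ≤ I.card}

/-- The partition `π` of the leaves `I` of `T(I)` is an edge partition: for some set `F` of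
edges, its blocks are given by the connected components of `T(I) \ F`. -/
def IsEdgePartition {n : ℕ} {V : Type*} (T : LeafTree n V) (I : Finset (Fin n))
    (π : Finpartition I) : Prop :=
  ∃ F ⊆ (T.sub I).edgeSet, ∀ i ∈ I, ∀ j ∈ I, (∃ B ∈ π.parts, i ∈ B ∧ j ∈ B) ↔
    ((T.sub I).spanningCoe.deleteEdges F).Reachable (T.leaf i) (T.leaf j)

/-- The poset `Π_{T(I)}` of edge partitions, ordered by refinement. -/
abbrev EdgePartition {n : ℕ} {V : Type*} (T : LeafTree n V) (I : Finset (Fin n)) : Type :=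
  {π : Finpartition I // IsEdgePartition T I π}

lemma sub_reachable {n : ℕ} {V : Type*} (T : LeafTree n V) {I : Finset (Fin n)} {i j : Fin n}
    (hi : i ∈ I) (hj : j ∈ I) :
    (T.sub I).spanningCoe.Reachable (T.leaf i) (T.leaf j) := by
  obtain ⟨w, hw⟩ := T.isTree.1.exists_isPath (T.leaf i) (T.leaf j)
  have key : ∀ H : T.graph.Subgraph,
      T.leaf '' (I : Set (Fin n)) ⊆ H.verts ∧ H.Connected →
        ∀ a b, s(a, b) ∈ w.edges → H.Adj a b := by
    rintro H ⟨hW, hc⟩ a b hab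
    obtain ⟨q⟩ := hc.coe.preconnected ⟨T.leaf i, hW ⟨i, hi, rfl⟩⟩ ⟨T.leaf j, hW ⟨j, hj, rfl⟩⟩
    classical
    obtain ⟨q, hq⟩ := q.toPath
    obtain ⟨w', hw', hE⟩ : ∃ w' : T.graph.Walk (T.leaf i) (T.leaf j), w'.IsPath ∧
        w'.edges = q.edges.map (Sym2.map H.hom) :=
      ⟨q.map H.hom, hq.map H.hom_injective,
        SimpleGraph.Walk.edges_map _ _⟩
    have e' : w = w' :=
      congrArg Subtype.val ((T.isTree.2.subsingleton_path _ _).elim ⟨w, hw⟩ ⟨w', hw'⟩)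
    rw [e', hE, List.mem_map] at hab
    obtain ⟨x, hx, hxe⟩ := hab
    have hx' := SimpleGraph.Walk.edges_subset_edgeSet _ hx
    induction x with | _ c d =>
    rw [SimpleGraph.mem_edgeSet] at hx'
    have hcd : H.Adj c d := hx'
    rw [← SimpleGraph.Subgraph.mem_edgeSet] at hcd ⊢
    rwa [← hxe]
  refine ⟨w.transfer _ fun e he => ?_⟩
  induction e with | _ a b =>
  rw [SimpleGraph.mem_edgeSet, SimpleGraph.Subgraph.spanningCoe_adj]
  unfold LeafTree.sub spanned
  rw [SimpleGraph.Subgraph.sInf_adj]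
  exact ⟨fun H hH => key H hH a b he, w.adj_of_mem_edges he⟩

lemma isEdgePartition_indiscrete {n : ℕ} {V : Type*} (T : LeafTree n V) {I : Finset (Fin n)}
    (hI : I ≠ ⊥) : IsEdgePartition T I (Finpartition.indiscrete hI) := by
  refine ⟨∅, Set.empty_subset _, fun i hi j hj => ⟨fun _ => ?_, fun _ => ?_⟩⟩
  · simpa using sub_reachable T hi hj
  · exact ⟨I, by simp, hi, hj⟩

lemma BigSet.ne_bot {n : ℕ} (I : BigSet n) : I.1 ≠ ⊥ := by
  rintro h
  have := I.2
  simp [h] at this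

/-- The maximal edge partition, with the single block `I`. -/
def oneHat {n : ℕ} {V : Type*} (T : LeafTree n V) (I : BigSet n) : EdgePartition T I.1 :=
  ⟨Finpartition.indiscrete I.ne_bot, isEdgePartition_indiscrete T I.ne_bot⟩

open Classical in
noncomputable instance {n : ℕ} {V : Type*} (T : LeafTree n V) (I : Finset (Fin n)) :
    Fintype (EdgePartition T I) := Fintype.ofFinite _

open Classical in
noncomputable instance {n : ℕ} {V : Type*} (T : LeafTree n V) (I : Finset (Fin n)) :
    LocallyFiniteOrder (EdgePartition T I) := Fintype.toLocallyFiniteOrder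

open Classical in
/-- The tree cumulant `κ_I = ∑_{π ∈ Π_{T(I)}} m_I(π, 1) ∏_{B ∈ π} μ_B`, where `m_I` is the
Möbius function of the poset `Π_{T(I)}` and `1` its maximal element, as a function of the central moments. -/
noncomputable def treeCumulant {n : ℕ} {V : Type*} (T : LeafTree n V)
    (μ : Finset (Fin n) → ℝ) (I : BigSet n) : ℝ :=
  ∑ π : EdgePartition T I.1, IncidenceAlgebra.mu ℝ π (oneHat T I) * ∏ B ∈ π.1.parts, μ B

/-- The change of coordinates from means and central moments to means and tree cumulants. -/
noncomputable def fμκ {n : ℕ} {V : Type*} (T : LeafTree n V)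
    (m : (Fin n → ℝ) × (Finset (Fin n) → ℝ)) : (Fin n → ℝ) × (BigSet n → ℝ) :=
  (m.1, treeCumulant T m.2)

/-- The space `K_T` of means and tree cumulants. -/
noncomputable def cumulantSpace {n : ℕ} {V : Type*} (T : LeafTree n V) :
    Set ((Fin n → ℝ) × (BigSet n → ℝ)) :=
  fμκ T '' momentSpace n

/-! ### Parameters -/

section Parameters

variable {n : ℕ} {V : Type*} [Fintype V]

open Classical in
noncomputable instance (T : LeafTree n V) (r : V) : Fintype (T.Edge r) := Fintype.ofFinite _

/-- The parameter space `Θ_T = [0,1]^{2|E|+1}`: the number `t` is the root parameter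
`P(Y_r = 1)`, and `θ (u, v) a` is `P(Y_v = 1 | Y_u = a)`. -/
def Theta (T : LeafTree n V) (r : V) : Set (ℝ × (T.Edge r → Fin 2 → ℝ)) :=
  {θ | θ.1 ∈ Set.Icc 0 1 ∧ ∀ e a, θ.2 e a ∈ Set.Icc 0 1}

/-- The mass function on `{0, 1}` with mass `t` at `1`. -/
def bern (t : ℝ) (a : Fin 2) : ℝ := if a = 1 then t else 1 - t

/-- The mass function of the Markov process on the rooted tree `T^r` with parameters `θ`. -/
noncomputable def jointProb (T : LeafTree n V) (r : V) (θ : ℝ × (T.Edge r → Fin 2 → ℝ))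
    (α : V → Fin 2) : ℝ :=
  bern θ.1 (α r) * ∏ e : T.Edge r, bern (θ.2 e (α e.1.1)) (α e.1.2)

open Classical in
/-- The change of parameters `μ̄_v = 1 - 2 λ_v` for nodes `v`, with `λ_v = E Y_v`, and
`η_{u,v} = θ^{(v)}_{1|1} - θ^{(v)}_{1|0}` for edges `(u, v)`. -/
noncomputable def fθω (T : LeafTree n V) (r : V) (θ : ℝ × (T.Edge r → Fin 2 → ℝ)) :
    (V → ℝ) × (T.Edge r → ℝ) :=
  (fun v => 1 - 2 * mean (jointProb T r θ) v, fun e => θ.2 e 1 - θ.2 e 0)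

/-- The parameter space `Ω_T`. -/
noncomputable def Omega (T : LeafTree n V) (r : V) : Set ((V → ℝ) × (T.Edge r → ℝ)) :=
  fθω T r '' Theta T r

open Classical in
/-- The root `r(I)` of `T(I)`: the unique node of `T(I)` whose parent is not in `T(I)`.
(Such a node exists for `I` nonempty; the `else` branch is never used.) -/
noncomputable def subRoot (T : LeafTree n V) (r : V) (I : Finset (Fin n)) : V :=
  if h : ∃ v ∈ (T.sub I).verts, ∀ u ∈ (T.sub I).verts, ¬ T.IsEdge r u v then h.choose else r

open Classical in
/-- The product formula: `λ_i = (1 - μ̄_i) / 2` for each leaf, and for each `I` with at least two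
elements the product
`(1/4) (1 - μ̄_{r(I)}²) ∏_{v ∈ V(I) \ I} μ̄_v^{deg v - 2} ∏_{(u,v) ∈ E(I)} η_{u,v}`,
with degrees taken in `T(I)`; these degrees are at least two for `v ∈ V(I) \ I`. -/
noncomputable def ψ (T : LeafTree n V) (r : V) (ω : (V → ℝ) × (T.Edge r → ℝ)) :
    (Fin n → ℝ) × (BigSet n → ℝ) :=
  (fun i => (1 - ω.1 (T.leaf i)) / 2,
   fun I => 1 / 4 * (1 - ω.1 (subRoot T r I.1) ^ 2) *
    (∏ v : V with v ∈ (T.sub I.1).verts ∧ v ∉ T.leaf '' (I.1 : Set (Fin n)),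
      ω.1 v ^ (((T.sub I.1).neighborSet v).ncard - 2)) *
    ∏ e : T.Edge r with (T.sub I.1).Adj e.1.1 e.1.2, ω.2 e)

end Parameters

end TreeCumulants

/-! The law of the leaves is computed on `T'` instead of `T`. Contracting `E'` gives a map `c` of
nodes (`Collapse`). A Markov process on `T` becomes one on `T'` when every contracted edge copies
the value of its tail (`expand`), and the law of the leaves does not change (`leafMarginal_expand`).

On a rooted tree the transition along (u,v) is the marginal law of Y_v plus the correction
η_{u,v}(Y_u − ℓ_u) times a sign ±1 given by Y_v (`bern_kernel`). Multiplying out over all edges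
writes a central moment as a sum over edge sets F of weights that factor over the nodes
(`sum_jointProb_mul_prod`). A weight vanishes as soon as F has a free end outside the index set
(`noFreeEnds_of_weight_ne_zero`). Hence the product of the block moments of an edge partition π is
the sum over those F whose components induce a refinement of π (`prod_centralMoment`). Möbius
inversion keeps the F that join all of I, and among them only the edge set of T'(I) can have nonzero
weight (`treeCumulant_eq_weight`).

So each tree cumulant is a single weight. Since degrees are at most three, its node factors involve
only powers up to the third, and these reduce to powers of 1 − 2ℓ_v and one variance at the root
(`weight_subEdges`). A fourth central moment would not have this form, which is why the cumulants of
a trivalent expansion are used.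

Back on `T`, contracted edges have η = 1, and the node factors over each fibre of `c` combine to the
correct power (`prod_pow_deg`). Finally the global Markov distributions on a tree are exactly the
processes with parameters in Θ (`markovModel_eq`), so both sides are images of Θ under the same map.
-/

namespace TreeCumulants

/-! ### Forests, rooted trees and spanned subtrees. -/

open SimpleGraph

/-! ### Reachability in forests -/

lemma reachable_of_forall_adj {V W : Type*} {G : SimpleGraph V} {G' : SimpleGraph W} (f : V → W)
    (h : ∀ a b, G.Adj a b → G'.Reachable (f a) (f b)) {x y : V} (hxy : G.Reachable x y) :
    G'.Reachable (f x) (f y) := by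
  obtain ⟨w⟩ := hxy
  induction w with
  | nil => exact Reachable.refl _
  | cons hab _ ih => exact (h _ _ hab).trans ih

lemma mem_of_reachable {V : Type*} {G : SimpleGraph V} (s : Set V)
    (h : ∀ a b, G.Adj a b → a ∈ s → b ∈ s) {x y : V} (hxy : G.Reachable x y) (hx : x ∈ s) :
    y ∈ s := by
  obtain ⟨w⟩ := hxy
  induction w with
  | nil => exact hx
  | cons hab _ ih => exact ih (h _ _ hab hx)

lemma exists_adj_of_reachable_ne {V : Type*} {G : SimpleGraph V} {x y : V}
    (h : G.Reachable x y) (hne : x ≠ y) : ∃ z, G.Adj x z := by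
  obtain ⟨w⟩ := h
  cases w with
  | nil => exact absurd rfl hne
  | cons hab _ => exact ⟨_, hab⟩

/-- Every edge of a forest is a bridge: a connection in `G₀` that does not use uv would survive its
deletion. -/
lemma adj_of_reachable {V : Type*} {G G₀ : SimpleGraph V} (hG : G.IsAcyclic) (hle : G₀ ≤ G)
    {u v : V} (huv : G.Adj u v) (h : G₀.Reachable u v) : G₀.Adj u v := by
  by_contra hn
  refine isBridge_iff.1 (isAcyclic_iff_forall_adj_isBridge.1 hG huv) (h.mono ?_)
  intro a b hab
  rw [deleteEdges_adj]
  refine ⟨hle hab, fun he => hn ?_⟩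
  rw [Set.mem_singleton_iff, Sym2.eq_iff] at he
  rcases he with ⟨rfl, rfl⟩ | ⟨rfl, rfl⟩
  · exact hab
  · exact hab.symm

/-- Paths in a forest are unique, so the path in `G₁` and the path in `G₂` coincide. -/
lemma reachable_inf {V : Type*} {G G₁ G₂ : SimpleGraph V} (hG : G.IsAcyclic) (h₁ : G₁ ≤ G)
    (h₂ : G₂ ≤ G) {x y : V} (hx₁ : G₁.Reachable x y) (hx₂ : G₂.Reachable x y) :
    (G₁ ⊓ G₂).Reachable x y := by
  obtain ⟨p, hp⟩ := hx₁.exists_isPath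
  refine ⟨p.transfer _ fun e he => ?_⟩
  induction e with | _ a b =>
  have hab := p.adj_of_mem_edges he
  refine ⟨hab, adj_of_reachable hG h₂ (h₁ hab) ?_⟩
  by_contra hn
  have hle : G₂ ≤ G.deleteEdges {s(a, b)} := by
    intro c d hcd
    rw [deleteEdges_adj]
    refine ⟨h₂ hcd, fun hc => hn ?_⟩
    rw [Set.mem_singleton_iff, Sym2.eq_iff] at hc
    rcases hc with ⟨rfl, rfl⟩ | ⟨rfl, rfl⟩
    · exact hcd.reachable
    · exact hcd.symm.reachable
  obtain ⟨q, hq⟩ := (hx₂.mono hle).exists_isPath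
  have e' : p.mapLe h₁ = (q.mapLe (deleteEdges_le _)) :=
    congrArg Subtype.val ((hG.subsingleton_path _ _).elim
      ⟨_, hp.mapLe h₁⟩ ⟨_, hq.mapLe (deleteEdges_le _)⟩)
  have he' : s(a, b) ∈ (p.mapLe h₁).edges := by rwa [Walk.edges_mapLe_eq_edges]
  rw [e', Walk.edges_mapLe_eq_edges] at he'
  have := q.adj_of_mem_edges he'
  simp at this

/-- The connected component of `a` in `G₀`, as a subgraph of `G`. -/
def componentSubgraph {V : Type*} {G : SimpleGraph V} (G₀ : SimpleGraph V) (hle : G₀ ≤ G) (a : V) :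
    G.Subgraph where
  verts := {x | G₀.Reachable a x}
  Adj x y := G₀.Adj x y ∧ G₀.Reachable a x
  adj_sub h := hle h.1
  edge_vert h := h.2
  symm := ⟨fun _ _ h => ⟨h.1.symm, h.2.trans h.1.reachable⟩⟩

lemma componentSubgraph_connected {V : Type*} {G : SimpleGraph V} (G₀ : SimpleGraph V)
    (hle : G₀ ≤ G) (a : V) : (componentSubgraph G₀ hle a).Connected := by
  have key : ∀ x (hx : G₀.Reachable a x),
      (componentSubgraph G₀ hle a).coe.Reachable ⟨a, Reachable.refl a⟩ ⟨x, hx⟩ := by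
    intro x hx
    obtain ⟨w⟩ := hx.symm
    induction w with
    | nil => exact Reachable.refl _
    | @cons x y z hab w ih =>
      have hy : G₀.Reachable z y := hx.trans hab.reachable
      refine (ih hy).trans (Adj.reachable ?_)
      exact ⟨hab.symm, hy⟩
  rw [Subgraph.connected_iff]
  refine ⟨⟨fun x y => ?_⟩, ⟨a, Reachable.refl a⟩⟩
  exact (key x.1 x.2).symm.trans (key y.1 y.2)

lemma spanned_le_component {V : Type*} {G : SimpleGraph V} {W : Set V} (G₀ : SimpleGraph V)
    (hle : G₀ ≤ G) (a : V) (h : ∀ w ∈ W, G₀.Reachable a w) :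
    spanned G W ≤ componentSubgraph G₀ hle a :=
  sInf_le ⟨fun w hw => h w hw, componentSubgraph_connected G₀ hle a⟩

/-- Each node outside `J` that has a neighbour has at least two. -/
def NoFreeEnds {V : Type*} (H : SimpleGraph V) (J : Set V) : Prop :=
  ∀ v ∉ J, ∀ w, H.Adj v w → ∃ w', w' ≠ w ∧ H.Adj v w'

namespace LeafTree

variable {n : ℕ} {V : Type*} (T : LeafTree n V)

/-! ### The rooted tree -/

lemma isEdge_or_isEdge (r : V) {u v : V} (h : T.graph.Adj u v) :
    T.IsEdge r u v ∨ T.IsEdge r v u := by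
  rcases T.isTree.dist_eq_dist_add_one_of_adj r h with h' | h'
  · exact Or.inr ⟨h.symm, h'⟩
  · exact Or.inl ⟨h, h'⟩

variable {T} in
lemma IsEdge.asymm {r u v : V} (h : T.IsEdge r u v) : ¬ T.IsEdge r v u := by
  intro h'
  have h1 := h.2
  have h2 := h'.2
  omega

variable {T} in
-- A geodesic to either parent extends to a geodesic to `v`, and paths in a tree are unique.
lemma IsEdge.unique {r u u' v : V} (h : T.IsEdge r u v) (h' : T.IsEdge r u' v) : u = u' := by
  have key : ∀ w, T.IsEdge r w v → ∃ p : T.graph.Walk r v, p.IsPath ∧ p.penultimate = w := by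
    intro w hw
    obtain ⟨q, hq⟩ := T.isTree.connected.exists_walk_length_eq_dist r w
    refine ⟨q.concat hw.1, Walk.isPath_of_length_eq_dist _ ?_, by simp⟩
    rw [Walk.length_concat, hq, hw.2]
  obtain ⟨p, hp, rfl⟩ := key u h
  obtain ⟨p', hp', rfl⟩ := key u' h'
  have : p = p' :=
    congrArg Subtype.val ((T.isTree.isAcyclic.subsingleton_path _ _).elim ⟨p, hp⟩ ⟨p', hp'⟩)
  rw [this]

lemma not_isEdge_root {r u : V} : ¬ T.IsEdge r u r := by
  intro h
  have := h.2
  simp at this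

lemma exists_isEdge {r v : V} (h : v ≠ r) : ∃ u, T.IsEdge r u v := by
  obtain ⟨p, hp⟩ := T.isTree.connected.exists_walk_length_eq_dist r v
  have hnil : ¬ p.Nil := fun hn => h hn.eq.symm
  have hadj := p.adj_penultimate hnil
  refine ⟨p.penultimate, ?_⟩
  rcases T.isEdge_or_isEdge r hadj with h' | h'
  · exact h'
  · have h1 := dist_le p.dropLast
    have h2 := h'.2
    have h3 : p.dropLast.length + 1 = p.length := by
      rw [← Walk.length_concat p.dropLast hadj, Walk.concat_dropLast]
    omega

/-- Distances are not preserved by contraction, but reachability is; this form of the orientation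
can be pushed forward. -/
lemma isEdge_iff_reachable {r u v : V} : T.IsEdge r u v ↔
    T.graph.Adj u v ∧ (T.graph.deleteEdges {s(u, v)}).Reachable r u := by
  have key : ∀ u v, T.IsEdge r u v → (T.graph.deleteEdges {s(u, v)}).Reachable r u := by
    intro u v h
    obtain ⟨p, hp⟩ := T.isTree.connected.exists_walk_length_eq_dist r u
    have hv : v ∉ p.support := by
      intro hv
      classical
      have h1 := dist_le (p.takeUntil v hv)
      have h2 := p.length_takeUntil_le_length hv
      have h3 := h.2
      omega
    refine ⟨p.toDeleteEdges _ fun e he hev => hv ?_⟩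
    rw [Set.mem_singleton_iff] at hev
    subst hev
    exact Walk.snd_mem_support_of_mem_edges _ he
  refine ⟨fun h => ⟨h.1, key u v h⟩, fun ⟨h, h'⟩ => ?_⟩
  rcases T.isEdge_or_isEdge r h with h1 | h1
  · exact h1
  · have h2 := key v u h1
    rw [Sym2.eq_swap] at h2
    exact absurd (h'.symm.trans h2)
      (isBridge_iff.1 (isAcyclic_iff_forall_adj_isBridge.1 T.isTree.isAcyclic h))

/-! ### Subgraphs without free ends -/

variable {T} in
-- Among the nodes reachable from `v` without uv, take one farthest from `u`. Outside `J` it would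
-- have two neighbours, of which only one can be its parent with respect to `u`; the other would be
-- farther still.
lemma exists_reachable_of_noFreeEnds [Finite V] {H : SimpleGraph V} {J : Set V} (hle : H ≤ T.graph)
    (hH : NoFreeEnds H J) {u v : V} (huv : H.Adj u v) :
    ∃ j ∈ J, (H.deleteEdges {s(u, v)}).Reachable v j := by
  classical
  have := Fintype.ofFinite V
  set K := H.deleteEdges {s(u, v)} with hK
  obtain ⟨x, hx, hmax⟩ := Finset.exists_max_image (Finset.univ.filter fun x => K.Reachable v x)
    (fun x => T.graph.dist u x) ⟨v, by simp⟩
  simp only [Finset.mem_filter, Finset.mem_univ, true_and] at hx hmax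
  refine ⟨x, ?_, hx⟩
  by_contra hxJ
  have hvu : ¬ K.Reachable v u := by
    intro h
    refine isBridge_iff.1 (isAcyclic_iff_forall_adj_isBridge.1 T.isTree.isAcyclic (hle huv))
      (h.symm.mono ?_)
    exact deleteEdges_mono hle
  have hxu : x ≠ u := by
    rintro rfl
    exact hvu hx
  obtain ⟨w, hw⟩ : ∃ w, H.Adj x w := by
    by_cases hxv : x = v
    · exact ⟨u, hxv ▸ huv.symm⟩
    · obtain ⟨z, hz⟩ := exists_adj_of_reachable_ne hx.symm hxv
      exact ⟨z, deleteEdges_le _ hz⟩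
  obtain ⟨w', hne, hw'⟩ := hH x hxJ w hw
  obtain ⟨z, hz, hxz⟩ : ∃ z, H.Adj x z ∧ T.IsEdge u x z := by
    rcases T.isEdge_or_isEdge u (hle hw) with h | h
    · exact ⟨w, hw, h⟩
    · rcases T.isEdge_or_isEdge u (hle hw') with h' | h'
      · exact ⟨w', hw', h'⟩
      · exact absurd (h'.unique h) hne
  have hKz : K.Adj x z := by
    rw [hK, deleteEdges_adj]
    refine ⟨hz, fun h => ?_⟩
    rw [Set.mem_singleton_iff, Sym2.eq_iff] at h
    rcases h with ⟨h, _⟩ | ⟨_, h⟩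
    · exact hxu h
    · subst h
      exact T.not_isEdge_root hxz
  have := hmax z (hx.trans hKz.reachable)
  have := hxz.2
  omega

variable {T} in
lemma exists_ends_of_noFreeEnds [Finite V] {H : SimpleGraph V} {J : Set V} (hle : H ≤ T.graph)
    (hH : NoFreeEnds H J) {u v : V} (huv : H.Adj u v) :
    ∃ i ∈ J, ∃ j ∈ J, (H.deleteEdges {s(u, v)}).Reachable u i ∧
      (H.deleteEdges {s(u, v)}).Reachable v j := by
  obtain ⟨j, hj, hvj⟩ := exists_reachable_of_noFreeEnds hle hH huv
  obtain ⟨i, hi, hui⟩ := exists_reachable_of_noFreeEnds hle hH huv.symm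
  rw [Sym2.eq_swap] at hui
  exact ⟨i, hi, j, hj, hui, hvj⟩

variable {T} in
/-- A subgraph without free ends outside `J` lies in each subgraph that joins the same nodes
of `J`. -/
lemma le_of_noFreeEnds [Finite V] {H G₀ : SimpleGraph V} {J : Set V} (hle : H ≤ T.graph)
    (hG₀ : G₀ ≤ T.graph) (hH : NoFreeEnds H J)
    (h : ∀ i ∈ J, ∀ j ∈ J, H.Reachable i j → G₀.Reachable i j) : H ≤ G₀ := by
  intro u v huv
  obtain ⟨i, hi, j, hj, hui, hvj⟩ := exists_ends_of_noFreeEnds hle hH huv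
  have hij := h i hi j hj (((hui.mono (deleteEdges_le _)).symm.trans huv.reachable).trans
    (hvj.mono (deleteEdges_le _)))
  -- If uv were missing from `G₀`, the route i to j through `G₀` would join its two ends without
  -- using the bridge uv.
  by_contra hn
  have hG : G₀ ≤ T.graph.deleteEdges {s(u, v)} := by
    intro c d hcd
    rw [deleteEdges_adj]
    refine ⟨hG₀ hcd, fun hc => hn ?_⟩
    rw [Set.mem_singleton_iff, Sym2.eq_iff] at hc
    rcases hc with ⟨rfl, rfl⟩ | ⟨rfl, rfl⟩
    · exact hcd
    · exact hcd.symm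
  refine isBridge_iff.1 (isAcyclic_iff_forall_adj_isBridge.1 T.isTree.isAcyclic (hle huv)) ?_
  exact ((hui.mono (deleteEdges_mono hle)).trans (hij.mono hG)).trans
    (hvj.mono (deleteEdges_mono hle)).symm

/-! ### Spanned subtrees -/

variable (I : Finset (Fin n))

lemma sub_spanningCoe_le : (T.sub I).spanningCoe ≤ T.graph := Subgraph.spanningCoe_le _

variable {I} in
lemma leaf_mem_sub {i : Fin n} (hi : i ∈ I) : T.leaf i ∈ (T.sub I).verts := by
  unfold sub spanned
  simp only [Subgraph.verts_sInf, Set.mem_iInter]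
  exact fun H hH => hH.1 ⟨i, hi, rfl⟩

variable {I} in
-- Minimality of T(I) in working form: T(I) lies in every subgraph of the tree that joins the leaves
-- of I.
lemma sub_le_of_reachable {i₀ : Fin n} (G₀ : SimpleGraph V) (hle : G₀ ≤ T.graph)
    (h : ∀ i ∈ I, G₀.Reachable (T.leaf i₀) (T.leaf i)) :
    (∀ x ∈ (T.sub I).verts, G₀.Reachable (T.leaf i₀) x) ∧
      ∀ x y, (T.sub I).Adj x y → G₀.Adj x y := by
  have := spanned_le_component (W := T.leaf '' (I : Set (Fin n))) G₀ hle (T.leaf i₀) (by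
    rintro _ ⟨i, hi, rfl⟩
    exact h i hi)
  exact ⟨fun x hx => this.1 hx, fun x y hxy => (this.2 hxy).1⟩

variable {I} in
lemma sub_reachable_of_mem {i₀ : Fin n} (hi₀ : i₀ ∈ I) {x : V} (hx : x ∈ (T.sub I).verts) :
    (T.sub I).spanningCoe.Reachable (T.leaf i₀) x :=
  (T.sub_le_of_reachable (T.sub I).spanningCoe (T.sub_spanningCoe_le I)
    fun _ hi => sub_reachable T hi₀ hi).1 x hx

variable {I} in
lemma exists_adj_of_mem_sub (hI : 2 ≤ I.card) {x : V} (hx : x ∈ (T.sub I).verts) :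
    ∃ y, (T.sub I).Adj x y := by
  obtain ⟨i, hi, j, hj, hij⟩ := Finset.one_lt_card.1 hI
  have hne : T.leaf i ≠ T.leaf j := fun h => hij (T.leaf_injective h)
  by_cases h : x = T.leaf i
  · subst h
    exact exists_adj_of_reachable_ne (sub_reachable T hi hj) hne
  · exact exists_adj_of_reachable_ne (T.sub_reachable_of_mem hi hx).symm h

/-- A path between leaves of I cannot visit an inner end v: it would enter and leave through the
same neighbour w. So the leaves stay joined when vw is deleted, against minimality. -/
lemma noFreeEnds_sub : NoFreeEnds (T.sub I).spanningCoe (T.leaf '' (I : Set (Fin n))) := by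
  intro v hv w hvw
  by_contra! hn
  obtain ⟨i₀, hi₀⟩ : I.Nonempty := by
    by_contra hI
    rw [Finset.not_nonempty_iff_eq_empty] at hI
    subst hI
    have hle := spanned_le_component (G := T.graph) (W := T.leaf '' ((∅ : Finset (Fin n)) : Set (Fin n)))
      ⊥ bot_le v (by simp)
    exact (hle.2 hvw).1
  set G₀ := (T.sub I).spanningCoe.deleteEdges {s(v, w)} with hG₀
  have hv₀ : ∀ y, ¬ G₀.Adj v y := by
    intro y hy
    rw [hG₀, deleteEdges_adj] at hy
    have : y = w := by
      by_contra h
      exact hn y h hy.1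
    subst this
    exact hy.2 rfl
  have key : ∀ i ∈ I, G₀.Reachable (T.leaf i₀) (T.leaf i) := by
    intro i hi
    obtain ⟨p, hp⟩ := (sub_reachable T hi₀ hi).exists_isPath
    have hvp : v ∉ p.support := by
      classical
      intro hvp
      have hv1 : T.leaf i₀ ≠ v := fun h => hv ⟨i₀, hi₀, h⟩
      have hv2 : T.leaf i ≠ v := fun h => hv ⟨i, hi, h⟩
      set q₁ := p.takeUntil v hvp with hq₁
      set q₂ := p.dropUntil v hvp with hq₂
      have hn1 : ¬ q₁.Nil := fun h => hv1 h.eq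
      have hn2 : ¬ q₂.Nil := fun h => hv2 h.eq.symm
      have h1 : q₁.penultimate = w := by
        by_contra h
        exact hn _ h (q₁.adj_penultimate hn1).symm
      have h2 : q₂.snd = w := by
        by_contra h
        exact hn _ h (q₂.adj_snd hn2)
      have hdis := hp
      rw [← p.take_spec hvp] at hdis
      have hnd := hdis.support_nodup
      rw [Walk.support_append, List.nodup_append] at hnd
      refine hnd.2.2 w ?_ w ?_ rfl
      · rw [← h1]
        exact Walk.getVert_mem_support _ _
      · rw [← h2]
        exact Walk.snd_mem_tail_support hn2
    refine ⟨p.toDeleteEdges _ fun e he hev => hvp ?_⟩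
    rw [Set.mem_singleton_iff] at hev
    subst hev
    exact Walk.fst_mem_support_of_mem_edges _ he
  have hsub := T.sub_le_of_reachable G₀ ((deleteEdges_le _).trans (T.sub_spanningCoe_le I)) key
  exact hv₀ w (hsub.2 v w hvw)

lemma sub_adj_of_mem {u v : V} (hu : u ∈ (T.sub I).verts) (hv : v ∈ (T.sub I).verts)
    (hI : I.Nonempty) (h : T.graph.Adj u v) : (T.sub I).Adj u v := by
  obtain ⟨i, hi⟩ := hI
  exact adj_of_reachable T.isTree.isAcyclic (T.sub_spanningCoe_le I) h
    ((T.sub_reachable_of_mem hi hu).symm.trans (T.sub_reachable_of_mem hi hv))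

variable {I} in
/-- All nodes of `T(I)` are descendants of a node of `T(I)` without parent in `T(I)`. -/
lemma dist_add_dist_of_no_parent (hI : I.Nonempty) {r a x : V} (ha : a ∈ (T.sub I).verts)
    (hpar : ∀ u ∈ (T.sub I).verts, ¬ T.IsEdge r u a) (hx : x ∈ (T.sub I).verts) :
    T.graph.dist r x = T.graph.dist r a + T.graph.dist a x := by
  obtain ⟨i, hi⟩ := hI
  have hax := (T.sub_reachable_of_mem hi ha).symm.trans (T.sub_reachable_of_mem hi hx)
  have hc := T.isTree.connected
  refine mem_of_reachable {x | T.graph.dist r x = T.graph.dist r a + T.graph.dist a x} ?_ hax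
    (by simp)
  intro x y hxy hx
  change T.graph.dist r x = T.graph.dist r a + T.graph.dist a x at hx
  change T.graph.dist r y = T.graph.dist r a + T.graph.dist a y
  have hxy' : T.graph.Adj x y := (T.sub I).adj_sub hxy
  have hy := hc.dist_triangle (u := r) (v := a) (w := y)
  rcases T.isEdge_or_isEdge r hxy' with h | h
  · have h1 := h.2
    have h2 := hc.dist_triangle (u := a) (v := x) (w := y)
    rw [dist_eq_one_iff_adj.2 hxy'] at h2
    omega
  · have hne : x ≠ a := by
      rintro rfl
      exact hpar y ((T.sub I).edge_vert hxy.symm) h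
    -- The neighbour z of x towards a is also closer to r, so it is the parent y of x.
    obtain ⟨z, hz⟩ := T.exists_isEdge (r := a) hne
    have h1 := hc.dist_triangle (u := r) (v := a) (w := z)
    have h2 := hz.2
    have hzx : T.IsEdge r z x := by
      rcases T.isEdge_or_isEdge r hz.1 with h' | h'
      · exact h'
      · have := h'.2
        omega
    have hzy := hzx.unique h
    subst hzy
    have := h.2
    omega

variable {I} in
lemma eq_of_no_parent (hI : I.Nonempty) {r a b : V} (ha : a ∈ (T.sub I).verts)
    (hb : b ∈ (T.sub I).verts) (hpa : ∀ u ∈ (T.sub I).verts, ¬ T.IsEdge r u a)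
    (hpb : ∀ u ∈ (T.sub I).verts, ¬ T.IsEdge r u b) : a = b := by
  have h1 := T.dist_add_dist_of_no_parent hI ha hpa hb
  have h2 := T.dist_add_dist_of_no_parent hI hb hpb ha
  exact (T.isTree.connected.dist_eq_zero_iff).1 (by omega)

variable {I} in
lemma subRoot_spec [Fintype V] (hI : I.Nonempty) (r : V) : subRoot T r I ∈ (T.sub I).verts ∧
    ∀ u ∈ (T.sub I).verts, ¬ T.IsEdge r u (subRoot T r I) := by
  have hex : ∃ v ∈ (T.sub I).verts, ∀ u ∈ (T.sub I).verts, ¬ T.IsEdge r u v := by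
    obtain ⟨i, hi⟩ := hI
    obtain ⟨x, hx, hmin⟩ := Set.exists_min_image (T.sub I).verts (fun x => T.graph.dist r x)
      (Set.toFinite _) ⟨_, T.leaf_mem_sub hi⟩
    refine ⟨x, hx, fun u hu h => ?_⟩
    have h1 := hmin u hu
    have h2 := h.2
    omega
  unfold subRoot
  rw [dif_pos hex]
  exact hex.choose_spec

end LeafTree

end TreeCumulants

/-! ### Expansion of the moments of a tree process over edge sets. -/

namespace TreeCumulants

open SimpleGraph

namespace LeafTree

open scoped Classical

set_option linter.unusedSectionVars false

variable {n : ℕ} {V : Type*} [Fintype V] (T : LeafTree n V) (r : V)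

/-! ### Expansion of the moments over sets of edges -/

variable {T r} in
lemma Edge.ext_snd {e e' : T.Edge r} (h : e.1.2 = e'.1.2) : e = e' := by
  obtain ⟨⟨u, v⟩, he⟩ := e
  obtain ⟨⟨u', v'⟩, he'⟩ := e'
  simp only at h he he'
  subst h
  have := he.unique he'
  subst this
  rfl

/-- Every node except the root is the head of exactly one edge. -/
lemma prod_nodes_eq (g : V → ℝ) : ∏ v, g v = g r * ∏ e : T.Edge r, g e.1.2 := by
  rw [← Finset.mul_prod_erase Finset.univ g (Finset.mem_univ r)]
  congr 1
  symm
  refine Finset.prod_bij (fun e _ => e.1.2) ?_ ?_ ?_ ?_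
  · intro e _
    rw [Finset.mem_erase]
    refine ⟨fun h => ?_, Finset.mem_univ _⟩
    have := e.2
    rw [h] at this
    exact T.not_isEdge_root this
  · intro e _ e' _ h
    exact Edge.ext_snd h
  · intro v hv
    obtain ⟨u, hu⟩ := T.exists_isEdge (Finset.ne_of_mem_erase hv)
    exact ⟨⟨(u, v), hu⟩, Finset.mem_univ _, rfl⟩
  · intro e _
    rfl

/-- The recursion for the node means along the edges of the rooted tree. -/
def MeanRecursion (θ : ℝ × (T.Edge r → Fin 2 → ℝ)) (ℓ : V → ℝ) : Prop :=
  ℓ r = θ.1 ∧ ∀ e : T.Edge r, ℓ e.1.2 = θ.2 e 0 + (θ.2 e 1 - θ.2 e 0) * ℓ e.1.1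

lemma exists_meanRecursion (θ : ℝ × (T.Edge r → Fin 2 → ℝ)) : ∃ ℓ, T.MeanRecursion r θ ℓ := by
  have key : ∀ k : ℕ, ∃ ℓ : V → ℝ, ℓ r = θ.1 ∧ ∀ e : T.Edge r, T.graph.dist r e.1.2 ≤ k →
      ℓ e.1.2 = θ.2 e 0 + (θ.2 e 1 - θ.2 e 0) * ℓ e.1.1 := by
    intro k
    induction k with
    | zero =>
      refine ⟨fun _ => θ.1, rfl, fun e he => ?_⟩
      have := e.2.2
      omega
    | succ k ih =>
      obtain ⟨ℓ, h0, hℓ⟩ := ih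
      -- Only nodes at depth k+1 are redefined, so the tails of the edges concerned keep their
      -- values. The chosen edge is the only one with head v.
      refine ⟨fun v => if h : ∃ e : T.Edge r, e.1.2 = v ∧ T.graph.dist r v = k + 1 then
        θ.2 h.choose 0 + (θ.2 h.choose 1 - θ.2 h.choose 0) * ℓ h.choose.1.1 else ℓ v, ?_, ?_⟩
      · refine (dif_neg ?_).trans h0
        rintro ⟨e, _, h⟩
        simp at h
      · intro e he
        have hd := e.2.2
        have h1 : ¬ ∃ e' : T.Edge r, e'.1.2 = e.1.1 ∧ T.graph.dist r e.1.1 = k + 1 := by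
          rintro ⟨_, _, h⟩
          omega
        simp only [dif_neg h1]
        by_cases hk : T.graph.dist r e.1.2 = k + 1
        · have h2 : ∃ e' : T.Edge r, e'.1.2 = e.1.2 ∧ T.graph.dist r e.1.2 = k + 1 := ⟨e, rfl, hk⟩
          rw [dif_pos h2, Edge.ext_snd h2.choose_spec.1]
        · rw [dif_neg (by rintro ⟨_, _, h⟩; exact hk h)]
          exact hℓ e (by omega)
  obtain ⟨ℓ, h0, hℓ⟩ := key (Finset.univ.sup fun v => T.graph.dist r v)
  exact ⟨ℓ, h0, fun e => hℓ e (Finset.le_sup (f := fun v => T.graph.dist r v) (Finset.mem_univ _))⟩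

variable {T r}

/-- The factor of the node `v` in the weight of a set `F` of edges and a set `J` of nodes. -/
noncomputable def nodeWeight (ℓ : V → ℝ) (F : Finset (T.Edge r)) (J : Finset V) (v : V) : ℝ :=
  ∑ a : Fin 2, (if ∃ e ∈ F, e.1.2 = v then (if a = 1 then 1 else -1) else bern (ℓ v) a) *
    (((a : ℕ) : ℝ) - ℓ v) ^ ((F.filter fun e => e.1.1 = v).card + if v ∈ J then 1 else 0)

/-- The contribution of a set `F` of edges to the central moment of a set `J` of nodes. -/
noncomputable def weight (θ : ℝ × (T.Edge r → Fin 2 → ℝ)) (ℓ : V → ℝ) (F : Finset (T.Edge r))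
    (J : Finset V) : ℝ :=
  (∏ e ∈ F, (θ.2 e 1 - θ.2 e 0)) * ∏ v, nodeWeight ℓ F J v

/-- The second summand is the law of the head when the tail has mean `l`; the first is of rank one
and linear in the centred tail. -/
lemma bern_kernel (θ₀ θ₁ l : ℝ) (a b : Fin 2) (f : Fin 2 → ℝ) (h0 : f 0 = θ₀) (h1 : f 1 = θ₁) :
    bern (f a) b = (θ₁ - θ₀) * (((a : ℕ) : ℝ) - l) * (if b = 1 then 1 else -1) +
      bern (θ₀ + (θ₁ - θ₀) * l) b := by
  fin_cases a <;> fin_cases b <;> simp [bern, h0, h1] <;> ring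

/-- F collects the edges at which the rank-one term is chosen. Each resulting product splits into
one factor per node, so the sum over all configurations becomes a product of sums over {0,1}. -/
theorem sum_jointProb_mul_prod {θ : ℝ × (T.Edge r → Fin 2 → ℝ)} {ℓ : V → ℝ}
    (hℓ : T.MeanRecursion r θ ℓ) (J : Finset V) :
    ∑ y : V → Fin 2, jointProb T r θ y * ∏ v ∈ J, (((y v : ℕ) : ℝ) - ℓ v) =
      ∑ F : Finset (T.Edge r), weight θ ℓ F J := by
  have hterm : ∀ (F : Finset (T.Edge r)) (y : V → Fin 2),
      bern θ.1 (y r) * ((∏ e ∈ F, ((θ.2 e 1 - θ.2 e 0) * (((y e.1.1 : ℕ) : ℝ) - ℓ e.1.1) *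
        (if y e.1.2 = 1 then 1 else -1))) * ∏ e ∈ Finset.univ \ F, bern (ℓ e.1.2) (y e.1.2)) *
        ∏ v ∈ J, (((y v : ℕ) : ℝ) - ℓ v) =
      (∏ e ∈ F, (θ.2 e 1 - θ.2 e 0)) * ∏ v,
        ((if ∃ e ∈ F, e.1.2 = v then (if y v = 1 then 1 else -1) else bern (ℓ v) (y v)) *
          (((y v : ℕ) : ℝ) - ℓ v) ^
            ((F.filter fun e => e.1.1 = v).card + if v ∈ J then 1 else 0)) := by
    intro F y
    have h1 : ∏ e ∈ F, (((y e.1.1 : ℕ) : ℝ) - ℓ e.1.1) =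
        ∏ v, (((y v : ℕ) : ℝ) - ℓ v) ^ (F.filter fun e => e.1.1 = v).card := by
      rw [← Finset.prod_fiberwise F (fun e => e.1.1)]
      refine Finset.prod_congr rfl fun v _ => ?_
      rw [← Finset.prod_const]
      refine Finset.prod_congr rfl fun e he => ?_
      rw [(Finset.mem_filter.1 he).2]
    have h2 : ∏ v ∈ J, (((y v : ℕ) : ℝ) - ℓ v) =
        ∏ v, (((y v : ℕ) : ℝ) - ℓ v) ^ (if v ∈ J then 1 else 0) := by
      rw [← Finset.prod_filter_mul_prod_filter_not Finset.univ (fun v => v ∈ J)]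
      rw [Finset.prod_eq_one (s := Finset.univ.filter fun v => ¬ v ∈ J), mul_one]
      · rw [Finset.filter_univ_mem]
        refine Finset.prod_congr rfl fun v hv => ?_
        rw [if_pos hv, pow_one]
      · intro v hv
        rw [if_neg (Finset.mem_filter.1 hv).2, pow_zero]
    -- Each node receives one factor from its incoming edge: a sign if that edge is in F, a
    -- Bernoulli mass otherwise. The root has no incoming edge and keeps its own mass.
    have h3 : ∏ v, (if ∃ e ∈ F, e.1.2 = v then (if y v = 1 then (1 : ℝ) else -1)
          else bern (ℓ v) (y v)) =
        bern θ.1 (y r) * ((∏ e ∈ F, (if y e.1.2 = 1 then (1 : ℝ) else -1)) *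
          ∏ e ∈ Finset.univ \ F, bern (ℓ e.1.2) (y e.1.2)) := by
      rw [T.prod_nodes_eq r, if_neg, hℓ.1]
      · congr 1
        rw [mul_comm, ← Finset.prod_sdiff (Finset.subset_univ F)]
        congr 1
        · refine Finset.prod_congr rfl fun e he => ?_
          rw [if_neg]
          rintro ⟨e', he', h⟩
          rw [Edge.ext_snd h] at he'
          exact (Finset.mem_sdiff.1 he).2 he'
        · refine Finset.prod_congr rfl fun e he => ?_
          rw [if_pos ⟨e, he, rfl⟩]
      · rintro ⟨e, _, h⟩
        have := e.2
        rw [h] at this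
        exact T.not_isEdge_root this
    simp_rw [pow_add, Finset.prod_mul_distrib]
    rw [h3, ← h1, ← h2]
    ring
  have hjoint : ∀ y : V → Fin 2, jointProb T r θ y * ∏ v ∈ J, (((y v : ℕ) : ℝ) - ℓ v) =
      ∑ F : Finset (T.Edge r), (∏ e ∈ F, (θ.2 e 1 - θ.2 e 0)) * ∏ v,
        ((if ∃ e ∈ F, e.1.2 = v then (if y v = 1 then 1 else -1) else bern (ℓ v) (y v)) *
          (((y v : ℕ) : ℝ) - ℓ v) ^
            ((F.filter fun e => e.1.1 = v).card + if v ∈ J then 1 else 0)) := by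
    intro y
    have hk : ∀ e : T.Edge r, bern (θ.2 e (y e.1.1)) (y e.1.2) =
        (θ.2 e 1 - θ.2 e 0) * (((y e.1.1 : ℕ) : ℝ) - ℓ e.1.1) * (if y e.1.2 = 1 then 1 else -1) +
          bern (ℓ e.1.2) (y e.1.2) := by
      intro e
      rw [hℓ.2 e]
      exact bern_kernel _ _ _ _ _ _ rfl rfl
    unfold jointProb
    simp_rw [hk]
    rw [Finset.prod_add, Finset.powerset_univ, Finset.mul_sum, Finset.sum_mul]
    exact Finset.sum_congr rfl fun F _ => hterm F y
  simp_rw [hjoint]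
  rw [Finset.sum_comm]
  refine Finset.sum_congr rfl fun F _ => ?_
  rw [← Finset.mul_sum, weight]
  congr 1
  unfold nodeWeight
  rw [Finset.prod_univ_sum, Fintype.piFinset_univ]

section NodeWeight

variable (ℓ : V → ℝ) (F : Finset (T.Edge r)) (J : Finset V) (v : V)

/-- The degree of `v` towards its children in `F`, plus one if `v` is in `J`. -/
noncomputable def lowerDegree : ℕ :=
  (F.filter fun e => e.1.1 = v).card + if v ∈ J then 1 else 0

variable {ℓ F J v}

lemma nodeWeight_of_not_incoming (h : ¬ ∃ e ∈ F, e.1.2 = v) :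
    nodeWeight ℓ F J v = (1 - ℓ v) * (-ℓ v) ^ lowerDegree F J v +
      ℓ v * (1 - ℓ v) ^ lowerDegree F J v := by
  unfold nodeWeight
  rw [Fin.sum_univ_two]
  simp [h, bern, lowerDegree]

lemma nodeWeight_of_incoming (h : ∃ e ∈ F, e.1.2 = v) :
    nodeWeight ℓ F J v = (1 - ℓ v) ^ lowerDegree F J v - (-ℓ v) ^ lowerDegree F J v := by
  unfold nodeWeight
  rw [Fin.sum_univ_two]
  simp only [h, if_true, lowerDegree]
  simp
  ring

lemma nodeWeight_eq_one (h : ¬ ∃ e ∈ F, e.1.2 = v) (hd : lowerDegree F J v = 0) :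
    nodeWeight ℓ F J v = 1 := by
  rw [nodeWeight_of_not_incoming h, hd]
  ring

lemma nodeWeight_eq_zero (h : ¬ ∃ e ∈ F, e.1.2 = v) (hd : lowerDegree F J v = 1) :
    nodeWeight ℓ F J v = 0 := by
  rw [nodeWeight_of_not_incoming h, hd]
  ring

lemma nodeWeight_eq_zero' (h : ∃ e ∈ F, e.1.2 = v) (hd : lowerDegree F J v = 0) :
    nodeWeight ℓ F J v = 0 := by
  rw [nodeWeight_of_incoming h, hd]
  ring

end NodeWeight

/-! ### The graph of a set of edges -/

/-- The graph with edge set `F`. -/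
def edgeGraph (F : Finset (T.Edge r)) : SimpleGraph V where
  Adj u v := ∃ e ∈ F, (e.1.1 = u ∧ e.1.2 = v) ∨ (e.1.1 = v ∧ e.1.2 = u)
  symm := ⟨fun _ _ ⟨e, he, h⟩ => ⟨e, he, h.symm⟩⟩
  loopless := ⟨fun v ⟨e, _, h⟩ => by
    have := e.2.1.ne
    rcases h with ⟨h1, h2⟩ | ⟨h1, h2⟩ <;> exact this (h1.trans h2.symm)⟩

lemma edgeGraph_adj {F : Finset (T.Edge r)} {e : T.Edge r} (he : e ∈ F) :
    (edgeGraph F).Adj e.1.1 e.1.2 := ⟨e, he, Or.inl ⟨rfl, rfl⟩⟩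

lemma edgeGraph_le (F : Finset (T.Edge r)) : edgeGraph F ≤ T.graph := by
  rintro u v ⟨e, _, ⟨rfl, rfl⟩ | ⟨rfl, rfl⟩⟩
  · exact e.2.1
  · exact e.2.1.symm

/-- At a node outside `J` with a single edge of `F`, the factor is zero: for an outgoing edge it is
the first centred moment, for an incoming edge the sum of the two signs. -/
lemma noFreeEnds_of_weight_ne_zero {θ : ℝ × (T.Edge r → Fin 2 → ℝ)} {ℓ : V → ℝ}
    {F : Finset (T.Edge r)} {J : Finset V} (h : weight θ ℓ F J ≠ 0) :
    NoFreeEnds (edgeGraph F) (J : Set V) := by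
  intro v hv w hvw
  by_contra! hn
  have hne : nodeWeight ℓ F J v ≠ 0 := by
    intro h0
    exact h (by rw [weight, Finset.prod_eq_zero (Finset.mem_univ v) h0, mul_zero])
  have hvJ : v ∉ J := fun h => hv (by exact_mod_cast h)
  have hw : ∀ x, (edgeGraph F).Adj v x → x = w := fun x hx => by
    by_contra hxw
    exact hn x hxw hx
  obtain ⟨e, he, ⟨h1, h2⟩ | ⟨h1, h2⟩⟩ := hvw
  · refine hne (nodeWeight_eq_zero ?_ ?_)
    · rintro ⟨e', he', h'⟩
      have hx := hw e'.1.1 (h' ▸ (edgeGraph_adj he').symm)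
      have hE := e'.2
      have hE' := e.2
      rw [hx, h'] at hE
      rw [h1, h2] at hE'
      exact hE.asymm hE'
    · unfold lowerDegree
      rw [if_neg hvJ, add_zero, Finset.card_eq_one]
      refine ⟨e, ?_⟩
      ext e'
      rw [Finset.mem_filter, Finset.mem_singleton]
      constructor
      · rintro ⟨he', h'⟩
        refine Edge.ext_snd ?_
        rw [h2]
        exact hw e'.1.2 (h' ▸ edgeGraph_adj he')
      · rintro rfl
        exact ⟨he, h1⟩
  · refine hne (nodeWeight_eq_zero' ⟨e, he, h2⟩ ?_)
    unfold lowerDegree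
    rw [if_neg hvJ, add_zero, Finset.card_eq_zero, Finset.filter_eq_empty_iff]
    intro e' he' h'
    have hx := hw e'.1.2 (h' ▸ edgeGraph_adj he')
    have hE := e'.2
    have hE' := e.2
    rw [hx, h'] at hE
    rw [h1, h2] at hE'
    exact hE.asymm hE'

lemma weight_empty_empty (θ : ℝ × (T.Edge r → Fin 2 → ℝ)) (ℓ : V → ℝ) :
    weight θ ℓ (∅ : Finset (T.Edge r)) ∅ = 1 := by
  unfold weight
  rw [Finset.prod_empty, one_mul]
  exact Finset.prod_eq_one fun v _ => nodeWeight_eq_one (by simp) (by simp [lowerDegree])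

/-- With at most one node in `J`, an edge set without free ends lies in every subgraph of the tree,
even the empty one. -/
lemma weight_eq_zero_of_subsingleton {θ : ℝ × (T.Edge r → Fin 2 → ℝ)} {ℓ : V → ℝ}
    {F : Finset (T.Edge r)} {J : Finset V} (hJ : (J : Set V).Subsingleton) (hF : F.Nonempty) :
    weight θ ℓ F J = 0 := by
  by_contra h
  have hle := le_of_noFreeEnds (G₀ := ⊥) (edgeGraph_le F) bot_le (noFreeEnds_of_weight_ne_zero h)
    (fun i hi j hj _ => by rw [hJ hi hj])
  obtain ⟨e, he⟩ := hF
  exact (hle (edgeGraph_adj he) : (⊥ : SimpleGraph V).Adj _ _)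

/-- In the expansion with empty index set only F = ∅ survives. The parameters may be arbitrary
reals. -/
lemma sum_jointProb (θ : ℝ × (T.Edge r → Fin 2 → ℝ)) : ∑ y, jointProb T r θ y = 1 := by
  obtain ⟨ℓ, hℓ⟩ := T.exists_meanRecursion r θ
  have h := sum_jointProb_mul_prod hℓ ∅
  simp only [Finset.prod_empty, mul_one] at h
  rw [h, Finset.sum_eq_single ∅, weight_empty_empty]
  · intro F _ hF
    exact weight_eq_zero_of_subsingleton (by simp) (Finset.nonempty_iff_ne_empty.2 hF)
  · simp

lemma mean_jointProb {θ : ℝ × (T.Edge r → Fin 2 → ℝ)} {ℓ : V → ℝ}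
    (hℓ : T.MeanRecursion r θ ℓ) (v : V) : mean (jointProb T r θ) v = ℓ v := by
  have h := sum_jointProb_mul_prod hℓ {v}
  simp only [Finset.prod_singleton, mul_sub, Finset.sum_sub_distrib] at h
  have h0 : ∑ F : Finset (T.Edge r), weight θ ℓ F {v} = 0 := by
    refine Finset.sum_eq_zero fun F _ => ?_
    rcases F.eq_empty_or_nonempty with rfl | hF
    · unfold weight
      rw [Finset.prod_eq_zero (Finset.mem_univ v), mul_zero]
      exact nodeWeight_eq_zero (by simp) (by simp [lowerDegree])
    · exact weight_eq_zero_of_subsingleton (by simp) hF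
  rw [← Finset.sum_mul, sum_jointProb, one_mul, h0] at h
  unfold mean
  linarith

end LeafTree

end TreeCumulants

/-! ### Tree cumulants as single weights, by Möbius inversion. -/

namespace TreeCumulants

open SimpleGraph

namespace LeafTree

open scoped Classical

set_option linter.unusedSectionVars false

variable {n : ℕ} {V : Type*} [Fintype V] {T : LeafTree n V} {r : V}

/-! ### Moments of the leaves -/

variable (T) in
/-- The leaves with labels in `I`. -/
noncomputable def leafSet (I : Finset (Fin n)) : Finset V := I.image T.leaf

lemma coe_leafSet (I : Finset (Fin n)) : (T.leafSet I : Set V) = T.leaf '' (I : Set (Fin n)) := by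
  simp [leafSet]

lemma sum_leafMarginal_mul (p : (V → Fin 2) → ℝ) (f : (Fin n → Fin 2) → ℝ) :
    ∑ x, leafMarginal T p x * f x = ∑ y, p y * f (fun i => y (T.leaf i)) := by
  unfold leafMarginal
  rw [← Finset.sum_fiberwise Finset.univ (fun y : V → Fin 2 => fun i => y (T.leaf i))]
  refine Finset.sum_congr rfl fun x _ => ?_
  rw [Finset.sum_mul]
  refine Finset.sum_congr ?_ fun y hy => ?_
  · ext y
    simp [funext_iff]
  · rw [Finset.mem_filter] at hy
    rw [hy.2]

lemma mean_leafMarginal (p : (V → Fin 2) → ℝ) (i : Fin n) :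
    mean (leafMarginal T p) i = mean p (T.leaf i) :=
  sum_leafMarginal_mul p fun x => ((x i : ℕ) : ℝ)

lemma centralMoment_leafMarginal {θ : ℝ × (T.Edge r → Fin 2 → ℝ)} {ℓ : V → ℝ}
    (hℓ : T.MeanRecursion r θ ℓ) (I : Finset (Fin n)) :
    centralMoment (leafMarginal T (jointProb T r θ)) I =
      ∑ F : Finset (T.Edge r), weight θ ℓ F (T.leafSet I) := by
  rw [← sum_jointProb_mul_prod hℓ]
  unfold centralMoment
  simp_rw [mean_leafMarginal, mean_jointProb hℓ]
  rw [sum_leafMarginal_mul _ fun x => ∏ i ∈ I, (((x i : ℕ) : ℝ) - ℓ (T.leaf i))]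
  refine Finset.sum_congr rfl fun y _ => ?_
  rw [leafSet, Finset.prod_image fun _ _ _ _ h => T.leaf_injective h]

/-! ### Products over disjoint regions -/

section Regions

variable (θ : ℝ × (T.Edge r → Fin 2 → ℝ)) (ℓ : V → ℝ)

lemma nodeWeight_union {F₁ F₂ : Finset (T.Edge r)} {J₁ J₂ : Finset V} {v : V}
    (hF : ∀ e ∈ F₂, e.1.1 ≠ v ∧ e.1.2 ≠ v) (hJ : v ∉ J₂) :
    nodeWeight ℓ (F₁ ∪ F₂) (J₁ ∪ J₂) v = nodeWeight ℓ F₁ J₁ v * nodeWeight ℓ F₂ J₂ v := by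
  have h2 : nodeWeight ℓ F₂ J₂ v = 1 := by
    refine nodeWeight_eq_one ?_ ?_
    · rintro ⟨e, he, h⟩
      exact (hF e he).2 h
    · unfold lowerDegree
      rw [if_neg hJ, add_zero, Finset.card_eq_zero, Finset.filter_eq_empty_iff]
      exact fun e he => (hF e he).1
  have h3 : (∃ e ∈ F₁ ∪ F₂, e.1.2 = v) ↔ ∃ e ∈ F₁, e.1.2 = v := by
    constructor
    · rintro ⟨e, he, h⟩
      rcases Finset.mem_union.1 he with he | he
      · exact ⟨e, he, h⟩
      · exact absurd h (hF e he).2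
    · rintro ⟨e, he, h⟩
      exact ⟨e, Finset.mem_union_left _ he, h⟩
  have h4 : (F₁ ∪ F₂).filter (fun e => e.1.1 = v) = F₁.filter fun e => e.1.1 = v := by
    rw [Finset.filter_union, Finset.filter_eq_empty_iff.2 fun e he => (hF e he).1,
      Finset.union_empty]
  have h5 : v ∈ J₁ ∪ J₂ ↔ v ∈ J₁ := by simp [hJ]
  rw [h2, mul_one]
  unfold nodeWeight
  simp only [h3, h4, h5]

/-- At each node one of the two factors is 1, since the other region does not touch it. -/
lemma weight_union {F₁ F₂ : Finset (T.Edge r)} {J₁ J₂ : Finset V} {R₁ R₂ : Set V}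
    (hR : Disjoint R₁ R₂) (hF₁ : ∀ e ∈ F₁, e.1.1 ∈ R₁ ∧ e.1.2 ∈ R₁)
    (hF₂ : ∀ e ∈ F₂, e.1.1 ∈ R₂ ∧ e.1.2 ∈ R₂) (hJ₁ : ∀ v ∈ J₁, v ∈ R₁) (hJ₂ : ∀ v ∈ J₂, v ∈ R₂) :
    weight θ ℓ (F₁ ∪ F₂) (J₁ ∪ J₂) = weight θ ℓ F₁ J₁ * weight θ ℓ F₂ J₂ := by
  have hdis : Disjoint F₁ F₂ := by
    rw [Finset.disjoint_left]
    intro e h1 h2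
    exact Set.disjoint_left.1 hR (hF₁ e h1).1 (hF₂ e h2).1
  have hnode : ∀ v, nodeWeight ℓ (F₁ ∪ F₂) (J₁ ∪ J₂) v =
      nodeWeight ℓ F₁ J₁ v * nodeWeight ℓ F₂ J₂ v := by
    intro v
    by_cases hv : v ∈ R₂
    · have hv1 : v ∉ R₁ := fun h => Set.disjoint_left.1 hR h hv
      rw [Finset.union_comm F₁, Finset.union_comm J₁, mul_comm]
      refine nodeWeight_union ℓ (fun e he => ⟨?_, ?_⟩) fun h => hv1 (hJ₁ v h)
      · rintro rfl
        exact hv1 (hF₁ e he).1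
      · rintro rfl
        exact hv1 (hF₁ e he).2
    · refine nodeWeight_union ℓ (fun e he => ⟨?_, ?_⟩) fun h => hv (hJ₂ v h)
      · rintro rfl
        exact hv (hF₂ e he).1
      · rintro rfl
        exact hv (hF₂ e he).2
  unfold weight
  rw [Finset.prod_union hdis, Finset.prod_congr rfl fun v _ => hnode v, Finset.prod_mul_distrib]
  ring

lemma sum_weight_union {S₁ S₂ : Finset (T.Edge r)} {J₁ J₂ : Finset V} {R₁ R₂ : Set V}
    (hR : Disjoint R₁ R₂) (hS₁ : ∀ e ∈ S₁, e.1.1 ∈ R₁ ∧ e.1.2 ∈ R₁)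
    (hS₂ : ∀ e ∈ S₂, e.1.1 ∈ R₂ ∧ e.1.2 ∈ R₂) (hJ₁ : ∀ v ∈ J₁, v ∈ R₁) (hJ₂ : ∀ v ∈ J₂, v ∈ R₂) :
    ∑ F ∈ (S₁ ∪ S₂).powerset, weight θ ℓ F (J₁ ∪ J₂) =
      (∑ F ∈ S₁.powerset, weight θ ℓ F J₁) * ∑ F ∈ S₂.powerset, weight θ ℓ F J₂ := by
  have hdis : Disjoint S₁ S₂ := by
    rw [Finset.disjoint_left]
    intro e h1 h2
    exact Set.disjoint_left.1 hR (hS₁ e h1).1 (hS₂ e h2).1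
  rw [Finset.sum_mul_sum, ← Finset.sum_product']
  symm
  refine Finset.sum_bij' (fun F _ => F.1 ∪ F.2) (fun F _ => (F ∩ S₁, F ∩ S₂)) ?_ ?_ ?_ ?_ ?_
  · intro F hF
    simp only [Finset.mem_product, Finset.mem_powerset] at hF ⊢
    exact Finset.union_subset_union hF.1 hF.2
  · intro F _
    simp only [Finset.mem_product, Finset.mem_powerset]
    exact ⟨Finset.inter_subset_right, Finset.inter_subset_right⟩
  · rintro ⟨F₁, F₂⟩ hF
    simp only [Finset.mem_product, Finset.mem_powerset] at hF
    have h1 : F₂ ∩ S₁ = ∅ := by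
      rw [← Finset.disjoint_iff_inter_eq_empty]
      exact (hdis.mono_right hF.2).symm
    have h2 : F₁ ∩ S₂ = ∅ := by
      rw [← Finset.disjoint_iff_inter_eq_empty]
      exact hdis.mono_left hF.1
    simp only [Finset.union_inter_distrib_right, h1, h2, Finset.inter_eq_left.2 hF.1,
      Finset.inter_eq_left.2 hF.2, Finset.union_empty, Finset.empty_union]
  · intro F hF
    rw [Finset.mem_powerset] at hF
    simp only [← Finset.inter_union_distrib_left, Finset.inter_eq_left.2 hF]
  · intro F hF
    simp only [Finset.mem_product, Finset.mem_powerset] at hF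
    exact (weight_union θ ℓ hR (fun e he => hS₁ e (hF.1 he)) (fun e he => hS₂ e (hF.2 he))
      hJ₁ hJ₂).symm

lemma prod_sum_weight {ι : Type*} (P : Finset ι) (S : ι → Finset (T.Edge r)) (J : ι → Finset V)
    (R : ι → Set V) (hR : ∀ B ∈ P, ∀ C ∈ P, B ≠ C → Disjoint (R B) (R C))
    (hS : ∀ B ∈ P, ∀ e ∈ S B, e.1.1 ∈ R B ∧ e.1.2 ∈ R B) (hJ : ∀ B ∈ P, ∀ v ∈ J B, v ∈ R B) :
    ∏ B ∈ P, ∑ F ∈ (S B).powerset, weight θ ℓ F (J B) =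
      ∑ F ∈ (P.biUnion S).powerset, weight θ ℓ F (P.biUnion J) := by
  induction P using Finset.induction_on with
  | empty => simp [weight_empty_empty]
  | insert B P hB ih =>
    rw [Finset.prod_insert hB, ih (fun C hC D hD => hR C (Finset.mem_insert_of_mem hC) D
      (Finset.mem_insert_of_mem hD)) (fun C hC => hS C (Finset.mem_insert_of_mem hC))
      (fun C hC => hJ C (Finset.mem_insert_of_mem hC)), Finset.biUnion_insert,
      Finset.biUnion_insert]
    refine (sum_weight_union θ ℓ (R₁ := R B) (R₂ := ⋃ C ∈ P, R C) ?_
      (hS B (Finset.mem_insert_self _ _)) ?_ (hJ B (Finset.mem_insert_self _ _)) ?_).symm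
    · simp only [Set.disjoint_iUnion_right]
      intro C hC
      refine hR B (Finset.mem_insert_self _ _) C (Finset.mem_insert_of_mem hC) ?_
      rintro rfl
      exact hB hC
    · intro e he
      obtain ⟨C, hC, he⟩ := Finset.mem_biUnion.1 he
      have := hS C (Finset.mem_insert_of_mem hC) e he
      exact ⟨Set.mem_biUnion hC this.1, Set.mem_biUnion hC this.2⟩
    · intro v hv
      obtain ⟨C, hC, hv⟩ := Finset.mem_biUnion.1 hv
      exact Set.mem_biUnion hC (hJ C (Finset.mem_insert_of_mem hC) v hv)

end Regions

/-! ### The edge partition of a set of edges -/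

lemma mem_block_unique {I : Finset (Fin n)} {π : Finpartition I} {B C : Finset (Fin n)}
    (hB : B ∈ π.parts) (hC : C ∈ π.parts) {i : Fin n} (hi : i ∈ B) (hi' : i ∈ C) : B = C :=
  π.disjoint.elim_finset hB hC i hi hi'

lemma finpartition_le_iff {I : Finset (Fin n)} {ρ π : Finpartition I} :
    ρ ≤ π ↔ ∀ i ∈ I, ∀ j ∈ I, (∃ B ∈ ρ.parts, i ∈ B ∧ j ∈ B) → ∃ B ∈ π.parts, i ∈ B ∧ j ∈ B := by
  constructor
  · rintro h i _ j _ ⟨B, hB, hi, hj⟩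
    obtain ⟨C, hC, hBC⟩ := h hB
    exact ⟨C, hC, hBC hi, hBC hj⟩
  · intro h B hB
    obtain ⟨i, hi⟩ := ρ.nonempty_of_mem_parts hB
    have hiI := ρ.subset hB hi
    obtain ⟨C, hC, hiC⟩ := π.exists_mem hiI
    refine ⟨C, hC, fun j hj => ?_⟩
    obtain ⟨D, hD, hiD, hjD⟩ := h i hiI j (ρ.subset hB hj) ⟨B, hB, hi, hj⟩
    rwa [mem_block_unique hC hD hiC hiD]

/-- The partition of the labels `I` induced by the components of the graph of `F`. -/
noncomputable def inducedPartition (F : Finset (T.Edge r)) (I : Finset (Fin n)) :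
    Finpartition I :=
  Finpartition.ofSetSetoid ((edgeGraph F).reachableSetoid.comap T.leaf) I

lemma inducedPartition_block (F : Finset (T.Edge r)) {I : Finset (Fin n)} {i j : Fin n}
    (hi : i ∈ I) (hj : j ∈ I) : (∃ B ∈ (inducedPartition F I).parts, i ∈ B ∧ j ∈ B) ↔
      (edgeGraph F).Reachable (T.leaf i) (T.leaf j) := by
  have h := Finpartition.mem_part_ofSetSetoid_iff_rel
    (s := (edgeGraph F).reachableSetoid.comap T.leaf) I (a := i) (b := j)
  rw [Finpartition.mem_part_iff_exists] at h
  rw [inducedPartition]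
  constructor
  · rintro ⟨B, hB, hiB, hjB⟩
    exact (h.1 ⟨B, hB, hjB, hiB⟩).2.2
  · intro hr
    obtain ⟨B, hB, h1, h2⟩ := h.2 ⟨hi, hj, hr⟩
    exact ⟨B, hB, h2, h1⟩

/-- `F` may leave T(I). Deleting from T(I) the edges not in `F` gives the same partition, since a
connection in `F` between leaves of `I` runs inside T(I) by `reachable_inf`. -/
lemma isEdgePartition_inducedPartition (F : Finset (T.Edge r)) (I : Finset (Fin n)) :
    IsEdgePartition T I (inducedPartition F I) := by
  refine ⟨(T.sub I).edgeSet \ (edgeGraph F).edgeSet, Set.sdiff_subset, fun i hi j hj => ?_⟩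
  rw [inducedPartition_block F hi hj]
  have hG : (T.sub I).spanningCoe.deleteEdges ((T.sub I).edgeSet \ (edgeGraph F).edgeSet) =
      (T.sub I).spanningCoe ⊓ edgeGraph F := by
    ext u v
    rw [deleteEdges_adj, inf_adj]
    simp only [Set.mem_sdiff, Subgraph.mem_edgeSet, mem_edgeSet, Subgraph.spanningCoe_adj]
    tauto
  rw [hG]
  refine ⟨fun h => ?_, fun h => h.mono inf_le_right⟩
  exact reachable_inf T.isTree.isAcyclic (T.sub_spanningCoe_le I) (edgeGraph_le F)
    (sub_reachable T hi hj) h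

/-- The induced partition as an element of the poset of edge partitions. -/
noncomputable def inducedEdgePartition (F : Finset (T.Edge r)) (I : Finset (Fin n)) :
    EdgePartition T I :=
  ⟨inducedPartition F I, isEdgePartition_inducedPartition F I⟩

lemma inducedEdgePartition_le_iff (F : Finset (T.Edge r)) {I : Finset (Fin n)}
    (π : EdgePartition T I) : inducedEdgePartition F I ≤ π ↔
      ∀ i ∈ I, ∀ j ∈ I, (edgeGraph F).Reachable (T.leaf i) (T.leaf j) →
        ∃ B ∈ π.1.parts, i ∈ B ∧ j ∈ B := by
  rw [← Subtype.coe_le_coe, finpartition_le_iff]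
  refine forall_congr' fun i => forall_congr' fun hi => forall_congr' fun j =>
    forall_congr' fun hj => ?_
  exact imp_congr_left (inducedPartition_block F hi hj)

lemma le_oneHat (I : BigSet n) (π : EdgePartition T I.1) : π ≤ oneHat T I := by
  rw [← Subtype.coe_le_coe, finpartition_le_iff]
  intro i hi j hj _
  exact ⟨I.1, by simp [oneHat], hi, hj⟩

lemma inducedEdgePartition_eq_oneHat_iff (F : Finset (T.Edge r)) (I : BigSet n) :
    inducedEdgePartition F I.1 = oneHat T I ↔
      ∀ i ∈ I.1, ∀ j ∈ I.1, (edgeGraph F).Reachable (T.leaf i) (T.leaf j) := by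
  constructor
  · intro h i hi j hj
    rw [← inducedPartition_block F hi hj]
    have : inducedPartition F I.1 = (oneHat T I).1 := congrArg Subtype.val h
    rw [this]
    exact ⟨I.1, by simp [oneHat], hi, hj⟩
  · intro h
    refine le_antisymm (le_oneHat _ _) ?_
    rw [← Subtype.coe_le_coe, finpartition_le_iff]
    intro i hi j hj _
    exact (inducedPartition_block F hi hj).2 (h i hi j hj)

/-! ### Tree cumulants as weights -/

/-- Let G be T(I) without the deleted edges. The blocks of π lie in distinct components of G, and
the moment of a block only sees edges of its own component; the product is therefore one sum over F
inside G. For F of nonzero weight, lying inside G is the same as inducing a refinement of π. -/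
theorem prod_centralMoment {θ : ℝ × (T.Edge r → Fin 2 → ℝ)} {ℓ : V → ℝ}
    (hℓ : T.MeanRecursion r θ ℓ) {I : Finset (Fin n)} (π : EdgePartition T I) :
    ∏ B ∈ π.1.parts, centralMoment (leafMarginal T (jointProb T r θ)) B =
      ∑ F : Finset (T.Edge r) with inducedEdgePartition F I ≤ π, weight θ ℓ F (T.leafSet I) := by
  obtain ⟨E₀, hE₀, hπ⟩ := π.2
  set G := (T.sub I).spanningCoe.deleteEdges E₀ with hG
  have hGle : G ≤ T.graph := (deleteEdges_le _).trans (T.sub_spanningCoe_le I)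
  set R : Finset (Fin n) → Set V := fun B => {x | ∃ i ∈ B, G.Reachable (T.leaf i) x} with hR
  set S : Finset (Fin n) → Finset (T.Edge r) := fun B => Finset.univ.filter fun e =>
    e.1.1 ∈ R B ∧ e.1.2 ∈ R B ∧ G.Adj e.1.1 e.1.2 with hS
  have hB : ∀ B ∈ π.1.parts, centralMoment (leafMarginal T (jointProb T r θ)) B =
      ∑ F ∈ (S B).powerset, weight θ ℓ F (T.leafSet B) := by
    intro B hB
    rw [centralMoment_leafMarginal hℓ]
    symm
    -- An edge set of nonzero weight has no free ends outside B, so it lies in G and hangs on leaves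
    -- of B; all others contribute zero.
    refine Finset.sum_subset (Finset.subset_univ _) fun F _ hF => ?_
    by_contra hw
    refine hF (Finset.mem_powerset.2 fun e he => ?_)
    have hfree := noFreeEnds_of_weight_ne_zero hw
    have hle : edgeGraph F ≤ G := by
      refine le_of_noFreeEnds (edgeGraph_le F) hGle hfree ?_
      rw [coe_leafSet]
      rintro _ ⟨i, hi, rfl⟩ _ ⟨j, hj, rfl⟩ _
      exact (hπ i (π.1.subset hB hi) j (π.1.subset hB hj)).1 ⟨B, hB, hi, hj⟩
    have hadj := edgeGraph_adj he
    obtain ⟨x, hx, -, -, hux, -⟩ := exists_ends_of_noFreeEnds (edgeGraph_le F) hfree hadj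
    rw [coe_leafSet] at hx
    obtain ⟨i, hi, rfl⟩ := hx
    have hu := ((hux.mono (deleteEdges_le _)).mono hle).symm
    rw [hS, Finset.mem_filter]
    exact ⟨Finset.mem_univ _, ⟨i, hi, hu⟩, ⟨i, hi, hu.trans (hle hadj).reachable⟩, hle hadj⟩
  have hI : π.1.parts.biUnion T.leafSet = T.leafSet I := by
    have h : π.1.parts.biUnion id = I := π.1.biUnion_parts
    unfold leafSet
    conv_rhs => rw [← h, Finset.biUnion_image]
    rfl
  rw [Finset.prod_congr rfl hB, prod_sum_weight θ ℓ π.1.parts S T.leafSet R, hI]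
  · have hfilter : (π.1.parts.biUnion S).powerset =
        Finset.univ.filter fun F => F ⊆ π.1.parts.biUnion S := by
      ext F
      simp
    rw [hfilter, Finset.sum_filter, Finset.sum_filter]
    refine Finset.sum_congr rfl fun F _ => ?_
    -- The two index conditions differ in general; they need to agree only where the weight is
    -- nonzero.
    by_cases hw : weight θ ℓ F (T.leafSet I) = 0
    · simp [hw]
    refine if_congr ?_ rfl rfl
    have hfree := noFreeEnds_of_weight_ne_zero hw
    rw [inducedEdgePartition_le_iff]
    constructor
    · intro hF i hi j hj hij
      rw [hπ i hi j hj]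
      refine hij.mono ?_
      intro u v huv
      obtain ⟨e, he, h⟩ := huv
      obtain ⟨B, -, heB⟩ := Finset.mem_biUnion.1 (hF he)
      have hadj := (Finset.mem_filter.1 heB).2.2.2
      rcases h with ⟨rfl, rfl⟩ | ⟨rfl, rfl⟩
      · exact hadj
      · exact hadj.symm
    · intro h e he
      have hle : edgeGraph F ≤ G := by
        refine le_of_noFreeEnds (edgeGraph_le F) hGle hfree ?_
        rw [coe_leafSet]
        rintro _ ⟨i, hi, rfl⟩ _ ⟨j, hj, rfl⟩ hij
        exact (hπ i hi j hj).1 (h i hi j hj hij)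
      have hadj := edgeGraph_adj he
      obtain ⟨x, hx, -, -, hux, -⟩ := exists_ends_of_noFreeEnds (edgeGraph_le F) hfree hadj
      rw [coe_leafSet] at hx
      obtain ⟨i, hi, rfl⟩ := hx
      have hu := ((hux.mono (deleteEdges_le _)).mono hle).symm
      obtain ⟨B, hB, hiB⟩ := π.1.exists_mem hi
      rw [Finset.mem_biUnion]
      refine ⟨B, hB, Finset.mem_filter.2 ⟨Finset.mem_univ _, ⟨i, hiB, hu⟩,
        ⟨i, hiB, hu.trans (hle hadj).reachable⟩, hle hadj⟩⟩
  · intro B hB C hC hBC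
    rw [Set.disjoint_left]
    rintro x ⟨i, hi, hix⟩ ⟨j, hj, hjx⟩
    obtain ⟨D, hD, hiD, hjD⟩ := (hπ i (π.1.subset hB hi) j (π.1.subset hC hj)).2
      (hix.trans hjx.symm)
    exact hBC ((mem_block_unique hB hD hi hiD).trans (mem_block_unique hC hD hj hjD).symm)
  · intro B _ e he
    have := (Finset.mem_filter.1 he).2
    exact ⟨this.1, this.2.1⟩
  · intro B _ v hv
    have : v ∈ (T.leafSet B : Set V) := hv
    rw [coe_leafSet] at this
    obtain ⟨i, hi, rfl⟩ := this
    exact ⟨i, hi, Reachable.refl _⟩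

/-- Möbius inversion at the top element: after exchanging sums, the coefficient of `w b` is the sum
of μ(a,t) over ρ b ≤ a ≤ t, which is 1 if ρ b = t and 0 otherwise. -/
lemma sum_mu_mul_sum {α β : Type*} [Fintype α] [PartialOrder α] [LocallyFiniteOrder α]
    [DecidableEq α] [Fintype β] (ρ : β → α) (w : β → ℝ) (t : α) (ht : ∀ a, a ≤ t) :
    ∑ a, IncidenceAlgebra.mu ℝ a t * ∑ b with ρ b ≤ a, w b = ∑ b with ρ b = t, w b := by
  simp_rw [Finset.mul_sum, Finset.sum_filter]
  rw [Finset.sum_comm]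
  refine Finset.sum_congr rfl fun b _ => ?_
  have h := IncidenceAlgebra.sum_Icc_mu_left (𝕜 := ℝ) (ρ b) t
  have hIcc : Finset.Icc (ρ b) t = Finset.univ.filter fun a => ρ b ≤ a := by
    ext a
    simp [ht a]
  rw [hIcc, Finset.sum_filter] at h
  calc ∑ a, (if ρ b ≤ a then IncidenceAlgebra.mu ℝ a t * w b else 0)
      = (∑ a, if ρ b ≤ a then IncidenceAlgebra.mu ℝ a t else 0) * w b := by
        rw [Finset.sum_mul]
        exact Finset.sum_congr rfl fun a _ => by split_ifs <;> simp
    _ = _ := by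
        rw [h]
        split_ifs <;> simp

variable (T r) in
/-- The directed edges of `T(I)`. -/
noncomputable def subEdges (I : Finset (Fin n)) : Finset (T.Edge r) :=
  Finset.univ.filter fun e => (T.sub I).Adj e.1.1 e.1.2

lemma mem_of_edgeGraph_adj {F : Finset (T.Edge r)} {e : T.Edge r}
    (h : (edgeGraph F).Adj e.1.1 e.1.2) : e ∈ F := by
  obtain ⟨e', he', ⟨h1, h2⟩ | ⟨h1, h2⟩⟩ := h
  · rwa [← Edge.ext_snd h2]
  · have := e'.2
    rw [h1, h2] at this
    exact absurd this e.2.asymm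

lemma edgeGraph_subEdges (I : Finset (Fin n)) :
    edgeGraph (T.subEdges r I) = (T.sub I).spanningCoe := by
  ext u v
  rw [Subgraph.spanningCoe_adj]
  constructor
  · rintro ⟨e, he, ⟨rfl, rfl⟩ | ⟨rfl, rfl⟩⟩
    · exact (Finset.mem_filter.1 he).2
    · exact (Finset.mem_filter.1 he).2.symm
  · intro h
    rcases T.isEdge_or_isEdge r ((T.sub I).adj_sub h) with h' | h'
    · exact ⟨⟨(u, v), h'⟩, Finset.mem_filter.2 ⟨Finset.mem_univ _, h⟩, Or.inl ⟨rfl, rfl⟩⟩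
    · exact ⟨⟨(v, u), h'⟩, Finset.mem_filter.2 ⟨Finset.mem_univ _, h.symm⟩, Or.inr ⟨rfl, rfl⟩⟩

/-- A surviving F joins all leaves of I, so it contains T(I) by minimality; absence of free ends
gives the reverse inclusion. -/
theorem treeCumulant_eq_weight {θ : ℝ × (T.Edge r → Fin 2 → ℝ)} {ℓ : V → ℝ}
    (hℓ : T.MeanRecursion r θ ℓ) (I : BigSet n) :
    treeCumulant T (centralMoment (leafMarginal T (jointProb T r θ))) I =
      weight θ ℓ (T.subEdges r I.1) (T.leafSet I.1) := by
  unfold treeCumulant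
  simp_rw [prod_centralMoment hℓ]
  rw [sum_mu_mul_sum _ _ _ (le_oneHat I), Finset.sum_eq_single_of_mem (T.subEdges r I.1)]
  · rw [Finset.mem_filter, inducedEdgePartition_eq_oneHat_iff, edgeGraph_subEdges]
    exact ⟨Finset.mem_univ _, fun i hi j hj => sub_reachable T hi hj⟩
  · intro F hF hne
    rw [Finset.mem_filter, inducedEdgePartition_eq_oneHat_iff] at hF
    by_contra hw
    have hfree := noFreeEnds_of_weight_ne_zero hw
    have hle : edgeGraph F ≤ (T.sub I.1).spanningCoe := by
      refine le_of_noFreeEnds (edgeGraph_le F) (T.sub_spanningCoe_le _) hfree ?_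
      rw [coe_leafSet]
      rintro _ ⟨i, hi, rfl⟩ _ ⟨j, hj, rfl⟩ _
      exact sub_reachable T hi hj
    obtain ⟨i₀, hi₀⟩ := Finset.nonempty_iff_ne_empty.2 I.ne_bot
    have hge := (T.sub_le_of_reachable (edgeGraph F) (edgeGraph_le F)
      fun i hi => hF.2 i₀ hi₀ i hi).2
    refine hne (Finset.ext fun e => ⟨fun he => ?_, fun he => ?_⟩)
    · exact Finset.mem_filter.2 ⟨Finset.mem_univ _, hle (edgeGraph_adj he)⟩
    · exact mem_of_edgeGraph_adj (hge _ _ (Finset.mem_filter.1 he).2)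

end LeafTree

end TreeCumulants

/-! ### Evaluation of the weight of a spanned subtree. -/

namespace TreeCumulants

open SimpleGraph

namespace LeafTree

open scoped Classical

set_option linter.unusedSectionVars false

variable {n : ℕ} {V : Type*} [Fintype V] {T : LeafTree n V} {r : V}

/-! ### Degrees in the spanned subtrees -/

lemma not_incoming_root {F : Finset (T.Edge r)} : ¬ ∃ e ∈ F, e.1.2 = r := by
  rintro ⟨e, _, h⟩
  have := e.2
  rw [h] at this
  exact T.not_isEdge_root this

lemma prod_heads (F : Finset (T.Edge r)) (y : V → ℝ) :
    ∏ e ∈ F, y e.1.2 = ∏ v, if ∃ e ∈ F, e.1.2 = v then y v else 1 := by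
  rw [T.prod_nodes_eq r, if_neg not_incoming_root, one_mul,
    ← Finset.prod_filter_mul_prod_filter_not Finset.univ (fun e => e ∈ F)]
  rw [Finset.prod_eq_one (s := Finset.univ.filter fun e => ¬ e ∈ F), mul_one]
  · rw [Finset.filter_univ_mem]
    exact Finset.prod_congr rfl fun e he => (if_pos ⟨e, he, rfl⟩).symm
  · intro e he
    rw [if_neg]
    rintro ⟨e', he', h⟩
    rw [Edge.ext_snd h] at he'
    exact (Finset.mem_filter.1 he).2 he'

lemma prod_tails (F : Finset (T.Edge r)) (y : V → ℝ) :
    ∏ e ∈ F, y e.1.1 = ∏ v, y v ^ (F.filter fun e => e.1.1 = v).card := by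
  rw [← Finset.prod_fiberwise F (fun e => e.1.1)]
  refine Finset.prod_congr rfl fun v _ => ?_
  rw [← Finset.prod_const]
  refine Finset.prod_congr rfl fun e he => ?_
  rw [(Finset.mem_filter.1 he).2]

lemma incoming_subEdges_iff {I : Finset (Fin n)} (hI : I.Nonempty) (v : V) :
    (∃ e ∈ T.subEdges r I, e.1.2 = v) ↔ v ∈ (T.sub I).verts ∧ v ≠ subRoot T r I := by
  have hs := T.subRoot_spec hI r
  constructor
  · rintro ⟨e, he, rfl⟩
    have hadj := (Finset.mem_filter.1 he).2
    refine ⟨(T.sub I).edge_vert hadj.symm, fun h => ?_⟩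
    have := e.2
    rw [h] at this
    exact hs.2 _ ((T.sub I).edge_vert hadj) this
  · rintro ⟨hv, hne⟩
    have : ∃ u ∈ (T.sub I).verts, T.IsEdge r u v := by
      by_contra! hn
      exact hne (T.eq_of_no_parent hI hv hs.1 hn hs.2)
    obtain ⟨u, hu, huv⟩ := this
    exact ⟨⟨(u, v), huv⟩, Finset.mem_filter.2 ⟨Finset.mem_univ _,
      T.sub_adj_of_mem I hu hv hI huv.1⟩, rfl⟩

lemma ncard_neighborSet_sub (I : Finset (Fin n)) (v : V) :
    ((T.sub I).neighborSet v).ncard = ((T.subEdges r I).filter fun e => e.1.1 = v).card +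
      if ∃ e ∈ T.subEdges r I, e.1.2 = v then 1 else 0 := by
  set A := ((T.subEdges r I).filter fun e => e.1.1 = v).image fun e => e.1.2 with hA
  set B := ((T.subEdges r I).filter fun e => e.1.2 = v).image fun e => e.1.1 with hB
  have hAB : (T.sub I).neighborSet v = ((A ∪ B : Finset V) : Set V) := by
    ext w
    rw [Subgraph.mem_neighborSet, ← Subgraph.spanningCoe_adj,
      ← edgeGraph_subEdges (r := r), Finset.coe_union, Set.mem_union]
    constructor
    · rintro ⟨e, he, ⟨h1, h2⟩ | ⟨h1, h2⟩⟩
      · exact Or.inl (Finset.mem_image.2 ⟨e, Finset.mem_filter.2 ⟨he, h1⟩, h2⟩)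
      · exact Or.inr (Finset.mem_image.2 ⟨e, Finset.mem_filter.2 ⟨he, h2⟩, h1⟩)
    · rintro (h | h)
      · obtain ⟨e, he, h2⟩ := Finset.mem_image.1 h
        obtain ⟨he, h1⟩ := Finset.mem_filter.1 he
        exact ⟨e, he, Or.inl ⟨h1, h2⟩⟩
      · obtain ⟨e, he, h2⟩ := Finset.mem_image.1 h
        obtain ⟨he, h1⟩ := Finset.mem_filter.1 he
        exact ⟨e, he, Or.inr ⟨h2, h1⟩⟩
  have hdis : Disjoint A B := by
    rw [Finset.disjoint_left]
    intro w h h'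
    obtain ⟨e, he, h2⟩ := Finset.mem_image.1 h
    obtain ⟨e', he', h2'⟩ := Finset.mem_image.1 h'
    have h1 := (Finset.mem_filter.1 he).2
    have h1' := (Finset.mem_filter.1 he').2
    have hE := e.2
    have hE' := e'.2
    rw [h1, h2] at hE
    rw [h1', h2'] at hE'
    exact hE.asymm hE'
  have hAc : A.card = ((T.subEdges r I).filter fun e => e.1.1 = v).card :=
    Finset.card_image_of_injective _ fun e e' h => Edge.ext_snd h
  have hBc : B.card = if ∃ e ∈ T.subEdges r I, e.1.2 = v then 1 else 0 := by
    split_ifs with h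
    · obtain ⟨e, he, hv⟩ := h
      rw [Finset.card_eq_one]
      refine ⟨e.1.1, ?_⟩
      have : (T.subEdges r I).filter (fun e => e.1.2 = v) = {e} := by
        ext e'
        rw [Finset.mem_filter, Finset.mem_singleton]
        exact ⟨fun h => Edge.ext_snd (h.2.trans hv.symm), fun h => h ▸ ⟨he, hv⟩⟩
      rw [hB, this, Finset.image_singleton]
    · rw [Finset.card_eq_zero, hB, Finset.image_eq_empty, Finset.filter_eq_empty_iff]
      exact fun e he hv => h ⟨e, he, hv⟩
  rw [hAB, Set.ncard_coe_finset, Finset.card_union_of_disjoint hdis, hAc, hBc]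

lemma ncard_neighborSet_sub_le (I : Finset (Fin n)) (v : V) :
    ((T.sub I).neighborSet v).ncard ≤ deg T.graph v :=
  Set.ncard_le_ncard ((T.sub I).neighborSet_subset v) (Set.toFinite _)

lemma ncard_neighborSet_leaf {I : Finset (Fin n)} (hI : 2 ≤ I.card) {i : Fin n} (hi : i ∈ I) :
    ((T.sub I).neighborSet (T.leaf i)).ncard = 1 := by
  have h1 := T.ncard_neighborSet_sub_le I (T.leaf i)
  have h2 : deg T.graph (T.leaf i) = 1 := by
    have : T.leaf i ∈ {v | deg T.graph v = 1} := T.range_leaf ▸ ⟨i, rfl⟩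
    exact this
  obtain ⟨y, hy⟩ := T.exists_adj_of_mem_sub hI (T.leaf_mem_sub hi)
  have h3 : 0 < ((T.sub I).neighborSet (T.leaf i)).ncard :=
    (Set.ncard_pos (Set.toFinite _)).2 ⟨y, hy⟩
  omega

lemma two_le_ncard_neighborSet {I : Finset (Fin n)} (hI : 2 ≤ I.card) {v : V}
    (hv : v ∈ (T.sub I).verts) (hvI : v ∉ T.leaf '' (I : Set (Fin n))) :
    2 ≤ ((T.sub I).neighborSet v).ncard := by
  obtain ⟨w, hw⟩ := T.exists_adj_of_mem_sub hI hv
  obtain ⟨w', hne, hw'⟩ := T.noFreeEnds_sub I v hvI w hw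
  have : ({w, w'} : Set V) ⊆ (T.sub I).neighborSet v := by
    rintro x (rfl | rfl)
    · exact hw
    · exact hw'
  have h := Set.ncard_le_ncard this (Set.toFinite _)
  rwa [Set.ncard_pair hne.symm] at h

lemma filter_tail_eq_empty {I : Finset (Fin n)} {v : V} (hv : v ∉ (T.sub I).verts) :
    ((T.subEdges r I).filter fun e => e.1.1 = v).card = 0 := by
  rw [Finset.card_eq_zero, Finset.filter_eq_empty_iff]
  rintro e he rfl
  exact hv ((T.sub I).edge_vert (Finset.mem_filter.1 he).2)

/-! ### The weight of a spanned subtree -/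

/-- The root of T(I) contributes a central Bernoulli moment of order 2 or 3, namely ℓ(1−ℓ) or
ℓ(1−ℓ)(1−2ℓ). Any other node of T(I) with k children, labels counted as children, contributes
(1−ℓ)^k − (−ℓ)^k, which is 1 or 1−2ℓ for k = 1, 2. -/
theorem weight_subEdges (hdeg : ∀ v, deg T.graph v ≠ 1 → deg T.graph v ≤ 3)
    (θ : ℝ × (T.Edge r → Fin 2 → ℝ)) (ℓ : V → ℝ) (I : BigSet n) :
    weight θ ℓ (T.subEdges r I.1) (T.leafSet I.1) =
      1 / 4 * (1 - (1 - 2 * ℓ (subRoot T r I.1)) ^ 2) *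
        (∏ v : V with v ∈ (T.sub I.1).verts ∧ v ∉ T.leaf '' (I.1 : Set (Fin n)),
          (1 - 2 * ℓ v) ^ (((T.sub I.1).neighborSet v).ncard - 2)) *
        ∏ e ∈ T.subEdges r I.1, (θ.2 e 1 - θ.2 e 0) := by
  have hne : I.1.Nonempty := Finset.nonempty_iff_ne_empty.2 I.ne_bot
  have hs := T.subRoot_spec hne r
  have hnode : ∀ v, nodeWeight ℓ (T.subEdges r I.1) (T.leafSet I.1) v =
      (if v = subRoot T r I.1 then ℓ v * (1 - ℓ v) else 1) *
      (if v ∈ (T.sub I.1).verts ∧ v ∉ T.leaf '' (I.1 : Set (Fin n)) then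
        (1 - 2 * ℓ v) ^ (((T.sub I.1).neighborSet v).ncard - 2) else 1) := by
    intro v
    have hd := T.ncard_neighborSet_sub (r := r) I.1 v
    have hinc := T.incoming_subEdges_iff (r := r) hne v
    by_cases hv : v ∈ (T.sub I.1).verts
    swap
    · have h1 : v ≠ subRoot T r I.1 := by
        rintro rfl
        exact hv hs.1
      rw [if_neg h1, if_neg (fun h => hv h.1), nodeWeight_eq_one (fun h => hv (hinc.1 h).1), mul_one]
      unfold lowerDegree
      rw [filter_tail_eq_empty hv, if_neg]
      intro h
      obtain ⟨i, hi, rfl⟩ := Finset.mem_image.1 h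
      exact hv (T.leaf_mem_sub hi)
    by_cases hJ : v ∈ T.leafSet I.1
    · have hJ' : v ∈ T.leaf '' (I.1 : Set (Fin n)) := by
        rw [← coe_leafSet]
        exact hJ
      -- A leaf of I has degree one in T(I). As the root it has one child besides its label, hence a
      -- variance; otherwise only the label counts and the factor is 1.
      have h1 : ((T.sub I.1).neighborSet v).ncard = 1 := by
        obtain ⟨i, hi, rfl⟩ := hJ'
        exact T.ncard_neighborSet_leaf I.2 hi
      rw [h1] at hd
      rw [if_neg (c := v ∈ (T.sub I.1).verts ∧ v ∉ T.leaf '' (I.1 : Set (Fin n)))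
        (fun h => h.2 hJ'), mul_one]
      by_cases hroot : v = subRoot T r I.1
      · have hi : ¬ ∃ e ∈ T.subEdges r I.1, e.1.2 = v := fun h => (hinc.1 h).2 hroot
        rw [if_neg hi, add_zero] at hd
        rw [if_pos hroot, nodeWeight_of_not_incoming hi]
        unfold lowerDegree
        rw [if_pos hJ, ← hd]
        ring
      · have hi : ∃ e ∈ T.subEdges r I.1, e.1.2 = v := hinc.2 ⟨hv, hroot⟩
        rw [if_pos hi] at hd
        rw [if_neg hroot, nodeWeight_of_incoming hi]
        unfold lowerDegree
        rw [if_pos hJ, ← hd]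
        ring
    · have hJ' : v ∉ T.leaf '' (I.1 : Set (Fin n)) := by
        rw [← coe_leafSet]
        exact hJ
      have h2 := T.two_le_ncard_neighborSet I.2 hv hJ'
      have h3 : ((T.sub I.1).neighborSet v).ncard ≤ 3 := by
        have h4 := T.ncard_neighborSet_sub_le I.1 v
        exact h4.trans (hdeg v (by omega))
      rw [if_pos (c := v ∈ (T.sub I.1).verts ∧ _) ⟨hv, hJ'⟩]
      by_cases hroot : v = subRoot T r I.1
      · have hi : ¬ ∃ e ∈ T.subEdges r I.1, e.1.2 = v := fun h => (hinc.1 h).2 hroot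
        rw [if_neg hi, add_zero] at hd
        rw [if_pos hroot, nodeWeight_of_not_incoming hi]
        unfold lowerDegree
        rw [if_neg hJ, add_zero, ← hd]
        generalize ((T.sub I.1).neighborSet v).ncard = d at h2 h3
        interval_cases d
        · norm_num
          ring
        · norm_num
          ring
      · have hi : ∃ e ∈ T.subEdges r I.1, e.1.2 = v := hinc.2 ⟨hv, hroot⟩
        rw [if_pos hi] at hd
        rw [if_neg hroot, nodeWeight_of_incoming hi]
        unfold lowerDegree
        rw [if_neg hJ, add_zero]
        generalize ((T.sub I.1).neighborSet v).ncard = d at h2 h3 hd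
        generalize ((T.subEdges r I.1).filter fun e => e.1.1 = v).card = k at hd
        interval_cases d
        · obtain rfl : k = 1 := by omega
          norm_num
        · obtain rfl : k = 2 := by omega
          norm_num
          ring
  unfold weight
  rw [Finset.prod_congr rfl fun v _ => hnode v, Finset.prod_mul_distrib, Finset.prod_ite_eq',
    if_pos (Finset.mem_univ _), Finset.prod_filter]
  ring

/-- The node factor of the product formula, expressed by a product over leaves and edges. -/
theorem prod_pow_deg_mul_sq (I : BigSet n) {y : V → ℝ} (hy : ∀ v, y v ≠ 0) :
    (∏ v : V with v ∈ (T.sub I.1).verts ∧ v ∉ T.leaf '' (I.1 : Set (Fin n)),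
      y v ^ (((T.sub I.1).neighborSet v).ncard - 2)) * y (subRoot T r I.1) ^ 2 =
      (∏ i ∈ I.1, y (T.leaf i)) * ∏ e ∈ T.subEdges r I.1, (y e.1.1 / y e.1.2) := by
  have hne : I.1.Nonempty := Finset.nonempty_iff_ne_empty.2 I.ne_bot
  have hs := T.subRoot_spec hne r
  have h1 : y (subRoot T r I.1) ^ 2 = ∏ v, if v = subRoot T r I.1 then y v ^ 2 else 1 := by
    rw [Finset.prod_ite_eq', if_pos (Finset.mem_univ _)]
  have h2 : ∏ i ∈ I.1, y (T.leaf i) = ∏ v, if v ∈ T.leafSet I.1 then y v else 1 := by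
    rw [← Finset.prod_filter, Finset.filter_univ_mem, leafSet,
      Finset.prod_image fun _ _ _ _ h => T.leaf_injective h]
  rw [Finset.prod_div_distrib, prod_heads, prod_tails, ← Finset.prod_div_distrib, h1, h2,
    Finset.prod_filter, ← Finset.prod_mul_distrib, ← Finset.prod_mul_distrib]
  -- Compare exponents node by node. The edge quotients contribute the number of children minus one
  -- for a parent: deg − 2 away from the root and deg at the root. A label adds one.
  refine Finset.prod_congr rfl fun v _ => ?_
  have hd := T.ncard_neighborSet_sub (r := r) I.1 v
  have hinc := T.incoming_subEdges_iff (r := r) hne v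
  have hyv := hy v
  by_cases hv : v ∈ (T.sub I.1).verts
  swap
  · have h1 : v ≠ subRoot T r I.1 := by
      rintro rfl
      exact hv hs.1
    have h2 : v ∉ T.leafSet I.1 := by
      intro h
      obtain ⟨i, hi, rfl⟩ := Finset.mem_image.1 h
      exact hv (T.leaf_mem_sub hi)
    rw [if_neg h1, if_neg (fun h => hv h.1), if_neg h2, if_neg (fun h => hv (hinc.1 h).1),
      filter_tail_eq_empty hv]
    norm_num
  by_cases hJ : v ∈ T.leafSet I.1
  · have hJ' : v ∈ T.leaf '' (I.1 : Set (Fin n)) := by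
      rw [← coe_leafSet]
      exact hJ
    have h1 : ((T.sub I.1).neighborSet v).ncard = 1 := by
      obtain ⟨i, hi, rfl⟩ := hJ'
      exact T.ncard_neighborSet_leaf I.2 hi
    rw [h1] at hd
    rw [if_neg (c := v ∈ (T.sub I.1).verts ∧ v ∉ T.leaf '' (I.1 : Set (Fin n))) (fun h => h.2 hJ'), if_pos hJ]
    by_cases hroot : v = subRoot T r I.1
    · have hi : ¬ ∃ e ∈ T.subEdges r I.1, e.1.2 = v := fun h => (hinc.1 h).2 hroot
      rw [if_neg hi, add_zero] at hd
      rw [if_pos hroot, if_neg hi, ← hd]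
      ring
    · have hi : ∃ e ∈ T.subEdges r I.1, e.1.2 = v := hinc.2 ⟨hv, hroot⟩
      rw [if_pos hi] at hd
      rw [if_neg hroot, if_pos hi,
        show ((T.subEdges r I.1).filter fun e => e.1.1 = v).card = 0 by omega]
      field_simp
  · have hJ' : v ∉ T.leaf '' (I.1 : Set (Fin n)) := by
      rw [← coe_leafSet]
      exact hJ
    have h2 := T.two_le_ncard_neighborSet I.2 hv hJ'
    rw [if_pos (c := v ∈ (T.sub I.1).verts ∧ _) ⟨hv, hJ'⟩, if_neg hJ]
    obtain ⟨m, hm⟩ := Nat.exists_eq_add_of_le' h2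
    by_cases hroot : v = subRoot T r I.1
    · have hi : ¬ ∃ e ∈ T.subEdges r I.1, e.1.2 = v := fun h => (hinc.1 h).2 hroot
      rw [if_neg hi, add_zero] at hd
      rw [if_pos hroot, if_neg hi, ← hd, hm, Nat.add_sub_cancel]
      ring
    · have hi : ∃ e ∈ T.subEdges r I.1, e.1.2 = v := hinc.2 ⟨hv, hroot⟩
      rw [if_pos hi] at hd
      rw [if_neg hroot, if_pos hi, hm, Nat.add_sub_cancel,
        show ((T.subEdges r I.1).filter fun e => e.1.1 = v).card = m + 1 by omega]
      field_simp
      ring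

end LeafTree

end TreeCumulants

/-! ### Transport along the contraction from `T'` to `T`. -/

namespace TreeCumulants

open SimpleGraph

/-- The graph of the edges of `G` that join nodes with the same image under `c`. -/
def fibreGraph {V V' : Type*} (G : SimpleGraph V') (c : V' → V) : SimpleGraph V' where
  Adj u v := G.Adj u v ∧ c u = c v
  symm := ⟨fun _ _ h => ⟨h.1.symm, h.2.symm⟩⟩
  loopless := ⟨fun _ h => h.1.ne rfl⟩

/-- `c` exhibits the tree `T` as a contraction of the tree `T'`. -/
structure Collapse {n : ℕ} {V V' : Type*} (T : LeafTree n V) (T' : LeafTree n V')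
    (c : V' → V) : Prop where
  surj : Function.Surjective c
  adj : ∀ {u v}, T'.graph.Adj u v → c u ≠ c v → T.graph.Adj (c u) (c v)
  lift : ∀ {a b}, T.graph.Adj a b → ∃ u v, T'.graph.Adj u v ∧ c u = a ∧ c v = b
  fibre : ∀ {u v}, c u = c v → (fibreGraph T'.graph c).Reachable u v
  leaf : ∀ i, c (T'.leaf i) = T.leaf i

lemma TrivalentExpansion.exists_collapse {n : ℕ} {V V' : Type*} {T : LeafTree n V}
    {T' : LeafTree n V'} (X : TrivalentExpansion T T') : ∃ c, Collapse T T' c := by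
  refine ⟨fun v => X.iso ((SimpleGraph.fromEdgeSet X.E').connectedComponentMk v), ?_, ?_, ?_, ?_,
    X.iso_leaf⟩
  · intro a
    obtain ⟨v, hv⟩ := (X.iso.symm a).exists_rep
    refine ⟨v, ?_⟩
    change X.iso (Quot.mk _ v) = a
    rw [hv, RelIso.apply_symm_apply]
  · intro u v huv hne
    rw [X.iso.map_adj_iff]
    exact ⟨fun h => hne (congrArg X.iso h), u, v, rfl, rfl, huv⟩
  · intro a b hab
    rw [← X.iso.symm.map_adj_iff] at hab
    obtain ⟨-, u, v, hu, hv, huv⟩ := hab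
    refine ⟨u, v, huv, ?_, ?_⟩
    · rw [hu, RelIso.apply_symm_apply]
    · rw [hv, RelIso.apply_symm_apply]
  · intro u v h
    have h := X.iso.injective h
    rw [ConnectedComponent.eq] at h
    refine h.mono ?_
    intro a b hab
    exact ⟨X.E'_subset ((fromEdgeSet_adj _).1 hab).1,
      congrArg X.iso (ConnectedComponent.eq.2 hab.reachable)⟩

namespace Collapse

open scoped Classical

set_option linter.unusedSectionVars false

variable {n : ℕ} {V V' : Type*} [Fintype V] [Fintype V'] {T : LeafTree n V} {T' : LeafTree n V'}
  {c : V' → V} (hc : Collapse T T' c)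

include hc

/-- Two edges with the same image are linked at both ends through fibres, so each could be bypassed
by the other; but edges of a tree are bridges. -/
lemma edge_unique {u v u₁ v₁ : V'} (h : T'.graph.Adj u v) (h₁ : T'.graph.Adj u₁ v₁)
    (hu : c u = c u₁) (hv : c v = c v₁) (hne : c u ≠ c v) : u = u₁ ∧ v = v₁ := by
  by_contra hn
  have hf : fibreGraph T'.graph c ≤ T'.graph.deleteEdges {s(u, v)} := by
    intro a b hab
    rw [deleteEdges_adj]
    refine ⟨hab.1, fun he => hne ?_⟩
    rw [Set.mem_singleton_iff, Sym2.eq_iff] at he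
    rcases he with ⟨rfl, rfl⟩ | ⟨rfl, rfl⟩
    · exact hab.2
    · exact hab.2.symm
  have h₂ : (T'.graph.deleteEdges {s(u, v)}).Adj u₁ v₁ := by
    rw [deleteEdges_adj]
    refine ⟨h₁, fun he => ?_⟩
    rw [Set.mem_singleton_iff, Sym2.eq_iff] at he
    rcases he with ⟨rfl, rfl⟩ | ⟨rfl, rfl⟩
    · exact hn ⟨rfl, rfl⟩
    · exact hne hu
  exact isBridge_iff.1 (isAcyclic_iff_forall_adj_isBridge.1 T'.isTree.isAcyclic h)
    ((((hc.fibre hu).mono hf).trans h₂.reachable).trans ((hc.fibre hv.symm).mono hf))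

lemma isEdge_map {r' u v : V'} (h : T'.IsEdge r' u v) (hne : c u ≠ c v) :
    T.IsEdge (c r') (c u) (c v) := by
  rw [T.isEdge_iff_reachable]
  refine ⟨hc.adj h.1 hne, reachable_of_forall_adj c ?_ (T'.isEdge_iff_reachable.1 h).2⟩
  intro a b hab
  rw [deleteEdges_adj] at hab
  by_cases hcab : c a = c b
  · rw [hcab]
  refine Adj.reachable ?_
  rw [deleteEdges_adj]
  refine ⟨hc.adj hab.1 hcab, fun he => hab.2 ?_⟩
  rw [Set.mem_singleton_iff, Sym2.eq_iff] at he ⊢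
  rcases he with ⟨h1, h2⟩ | ⟨h1, h2⟩
  · exact Or.inl (hc.edge_unique hab.1 h.1 h1 h2 hcab)
  · exact Or.inr (hc.edge_unique hab.1 h.1.symm h1 h2 hcab)

/-- The image of an edge that is not collapsed. -/
def mapEdge {r' : V'} (e : T'.Edge r') (h : c e.1.1 ≠ c e.1.2) : T.Edge (c r') :=
  ⟨(c e.1.1, c e.1.2), hc.isEdge_map e.2 h⟩

/-- The edges that are not collapsed correspond one to one to edges of `T`, and collapsed edges
contribute 1. -/
lemma prod_edges {r' : V'} {F' : Finset (T'.Edge r')} {F : Finset (T.Edge (c r'))}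
    (h₁ : ∀ e ∈ F', ∀ h : c e.1.1 ≠ c e.1.2, hc.mapEdge e h ∈ F)
    (h₂ : ∀ e ∈ F, ∃ e' ∈ F', c e'.1.1 = e.1.1 ∧ c e'.1.2 = e.1.2)
    {g' : T'.Edge r' → ℝ} {g : T.Edge (c r') → ℝ} (hg₁ : ∀ e, c e.1.1 = c e.1.2 → g' e = 1)
    (hg : ∀ e h, g' e = g (hc.mapEdge e h)) : ∏ e ∈ F', g' e = ∏ e ∈ F, g e := by
  rw [← Finset.prod_filter_of_ne (p := fun e => c e.1.1 ≠ c e.1.2)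
    fun e _ h h' => h (hg₁ e h')]
  refine Finset.prod_bij (fun e he => hc.mapEdge e (Finset.mem_filter.1 he).2) ?_ ?_ ?_ ?_
  · intro e he
    exact h₁ e (Finset.mem_filter.1 he).1 _
  · intro e he e' he' h
    have h := Subtype.ext_iff.1 h
    have hu : c e.1.1 = c e'.1.1 := congrArg Prod.fst h
    have hv : c e.1.2 = c e'.1.2 := congrArg Prod.snd h
    exact LeafTree.Edge.ext_snd
      (hc.edge_unique e.2.1 e'.2.1 hu hv (Finset.mem_filter.1 he).2).2
  · intro e he
    obtain ⟨e', he', hu, hv⟩ := h₂ e he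
    have hne : c e'.1.1 ≠ c e'.1.2 := by
      rw [hu, hv]
      exact e.2.1.ne
    exact ⟨e', Finset.mem_filter.2 ⟨he', hne⟩, LeafTree.Edge.ext_snd hv⟩
  · intro e he
    exact hg e _

lemma exists_edge_of_adj {r' u v : V'} {e : T.Edge (c r')} (h : T'.graph.Adj u v)
    (hu : c u = e.1.1) (hv : c v = e.1.2) : T'.IsEdge r' u v := by
  rcases T'.isEdge_or_isEdge r' h with h' | h'
  · exact h'
  · have hne : c v ≠ c u := by
      rw [hu, hv]
      exact e.2.1.ne.symm
    have := hc.isEdge_map h' hne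
    rw [hu, hv] at this
    exact absurd this e.2.asymm

/-! ### Parameters on the expanded tree -/

/-- The parameters on `T'` for which collapsed edges copy the value of their tail. -/
noncomputable def expand {r' : V'} (θ : ℝ × (T.Edge (c r') → Fin 2 → ℝ)) :
    ℝ × (T'.Edge r' → Fin 2 → ℝ) :=
  (θ.1, fun e a => if h : c e.1.1 ≠ c e.1.2 then θ.2 (hc.mapEdge e h) a else ((a : ℕ) : ℝ))

lemma expand_of_ne {r' : V'} (θ : ℝ × (T.Edge (c r') → Fin 2 → ℝ)) (e : T'.Edge r')
    (h : c e.1.1 ≠ c e.1.2) : (hc.expand θ).2 e = θ.2 (hc.mapEdge e h) := by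
  funext a
  exact dif_pos h

lemma expand_of_eq {r' : V'} (θ : ℝ × (T.Edge (c r') → Fin 2 → ℝ)) (e : T'.Edge r')
    (h : c e.1.1 = c e.1.2) (a : Fin 2) : (hc.expand θ).2 e a = ((a : ℕ) : ℝ) :=
  dif_neg (not_not.2 h)

omit hc in
lemma bern_natCast (a b : Fin 2) : bern ((a : ℕ) : ℝ) b = if a = b then 1 else 0 := by
  fin_cases a <;> fin_cases b <;> simp [bern]

lemma meanRecursion_expand {r' : V'} {θ : ℝ × (T.Edge (c r') → Fin 2 → ℝ)} {ℓ : V → ℝ}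
    (hℓ : T.MeanRecursion (c r') θ ℓ) : T'.MeanRecursion r' (hc.expand θ) (ℓ ∘ c) := by
  refine ⟨hℓ.1, fun e => ?_⟩
  by_cases h : c e.1.1 = c e.1.2
  · simp [hc.expand_of_eq θ e h, h]
  · rw [hc.expand_of_ne θ e h]
    exact hℓ.2 (hc.mapEdge e h)

lemma jointProb_expand {r' : V'} (θ : ℝ × (T.Edge (c r') → Fin 2 → ℝ)) (α : V → Fin 2) :
    jointProb T' r' (hc.expand θ) (α ∘ c) = jointProb T (c r') θ α := by
  unfold jointProb
  congr 1
  refine hc.prod_edges (fun e _ h => Finset.mem_univ _) ?_ ?_ ?_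
  · intro e _
    obtain ⟨u, v, huv, hu, hv⟩ := hc.lift e.2.1
    exact ⟨⟨(u, v), hc.exists_edge_of_adj huv hu hv⟩, Finset.mem_univ _, hu, hv⟩
  · intro e h
    rw [hc.expand_of_eq θ e h, bern_natCast, Function.comp_apply, Function.comp_apply, h,
      if_pos rfl]
  · intro e h
    rw [hc.expand_of_ne θ e h]
    rfl

/-- A configuration that is not constant on the fibres disagrees across some collapsed edge, and
copying gives this probability zero. -/
lemma jointProb_expand_eq_zero {r' : V'} (θ : ℝ × (T.Edge (c r') → Fin 2 → ℝ))
    {α : V' → Fin 2} (hα : ∀ β : V → Fin 2, β ∘ c ≠ α) :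
    jointProb T' r' (hc.expand θ) α = 0 := by
  obtain ⟨e, he, hne⟩ : ∃ e : T'.Edge r', c e.1.1 = c e.1.2 ∧ α e.1.1 ≠ α e.1.2 := by
    by_contra! hn
    have hconst : ∀ u v, c u = c v → α v = α u := by
      intro u v huv
      refine mem_of_reachable {x | α x = α u} ?_ (hc.fibre huv) rfl
      intro a b hab ha
      change α a = α u at ha
      change α b = α u
      rw [← ha]
      rcases T'.isEdge_or_isEdge r' hab.1 with h | h
      · exact (hn ⟨(a, b), h⟩ hab.2).symm
      · exact hn ⟨(b, a), h⟩ hab.2.symm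
    refine hα (fun a => α (Function.surjInv hc.surj a)) (funext fun v => ?_)
    exact hconst _ _ (Function.surjInv_eq hc.surj (c v)).symm
  unfold jointProb
  rw [Finset.prod_eq_zero (Finset.mem_univ e), mul_zero]
  rw [hc.expand_of_eq θ e he, bern_natCast, if_neg hne]

theorem leafMarginal_expand {r' : V'} (θ : ℝ × (T.Edge (c r') → Fin 2 → ℝ)) :
    leafMarginal T' (jointProb T' r' (hc.expand θ)) = leafMarginal T (jointProb T (c r') θ) := by
  funext x
  unfold leafMarginal
  symm
  refine Finset.sum_of_injOn (fun α => α ∘ c) ?_ ?_ ?_ ?_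
  · exact (hc.surj.injective_comp_right).injOn
  · intro α hα
    simp only [Finset.coe_filter, Finset.mem_univ, true_and] at hα ⊢
    intro i
    rw [Function.comp_apply, hc.leaf]
    exact hα i
  · intro α hα hn
    refine hc.jointProb_expand_eq_zero θ fun β hβ => hn ⟨β, ?_, hβ⟩
    simp only [Finset.coe_filter, Finset.mem_filter, Finset.mem_univ, true_and] at hα ⊢
    intro i
    rw [← hc.leaf, ← hα i, ← hβ]
    rfl
  · intro α _
    exact (hc.jointProb_expand θ α).symm

/-! ### Spanned subtrees of the contraction -/

variable {I : Finset (Fin n)}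

/-- The edges of `T'` that are collapsed or map into T(I) join the leaves of I, so T'(I) is
contained in them. -/
lemma sub_map (hI : I.Nonempty) : (∀ x ∈ (T'.sub I).verts, c x ∈ (T.sub I).verts) ∧
    ∀ u v, (T'.sub I).Adj u v → c u ≠ c v → (T.sub I).Adj (c u) (c v) := by
  obtain ⟨i₀, hi₀⟩ := hI
  let G₀ : SimpleGraph V' :=
    { Adj := fun u v => T'.graph.Adj u v ∧ (c u = c v ∨ (T.sub I).Adj (c u) (c v))
      symm := ⟨fun _ _ h => ⟨h.1.symm, h.2.imp Eq.symm fun h => h.symm⟩⟩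
      loopless := ⟨fun _ h => h.1.ne rfl⟩ }
  have hfib : fibreGraph T'.graph c ≤ G₀ := fun a b h => ⟨h.1, Or.inl h.2⟩
  have hreach : ∀ i ∈ I, G₀.Reachable (T'.leaf i₀) (T'.leaf i) := by
    intro i hi
    have := mem_of_reachable {a | ∀ x, c x = a → G₀.Reachable (T'.leaf i₀) x} ?_
      (sub_reachable T hi₀ hi) ?_
    · exact this _ (hc.leaf i)
    · intro a b hab ha x hx
      obtain ⟨u, v, huv, hu, hv⟩ := hc.lift ((T.sub I).adj_sub hab)
      refine ((ha u hu).trans (Adj.reachable ?_)).trans ((hc.fibre (hv.trans hx.symm)).mono hfib)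
      refine ⟨huv, Or.inr ?_⟩
      rw [hu, hv]
      exact hab
    · intro x hx
      exact (hc.fibre ((hc.leaf i₀).trans hx.symm)).mono hfib
  have h := T'.sub_le_of_reachable G₀ (fun _ _ h => h.1) hreach
  refine ⟨fun x hx => ?_, fun u v huv hne => ((h.2 u v huv).2.resolve_left hne)⟩
  refine mem_of_reachable {x | c x ∈ (T.sub I).verts} ?_ (h.1 x hx) ?_
  · rintro a b ⟨-, hab | hab⟩ ha
    · change c b ∈ (T.sub I).verts
      rw [← hab]
      exact ha
    · exact (T.sub I).edge_vert hab.symm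
  · change c (T'.leaf i₀) ∈ (T.sub I).verts
    rw [hc.leaf]
    exact T.leaf_mem_sub hi₀

/-- The image of T'(I) joins the leaves of I in `T`, so it contains T(I). -/
lemma sub_lift (hI : I.Nonempty) :
    (∀ a ∈ (T.sub I).verts, ∃ x ∈ (T'.sub I).verts, c x = a) ∧
      ∀ a b, (T.sub I).Adj a b → ∃ u v, (T'.sub I).Adj u v ∧ c u = a ∧ c v = b := by
  obtain ⟨i₀, hi₀⟩ := hI
  let G₀ : SimpleGraph V :=
    { Adj := fun a b => a ≠ b ∧ ∃ u v, (T'.sub I).Adj u v ∧ c u = a ∧ c v = b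
      symm := ⟨fun _ _ ⟨h, u, v, huv, hu, hv⟩ => ⟨h.symm, v, u, huv.symm, hv, hu⟩⟩
      loopless := ⟨fun _ h => h.1 rfl⟩ }
  have hle : G₀ ≤ T.graph := by
    rintro _ _ ⟨h, u, v, huv, rfl, rfl⟩
    exact hc.adj ((T'.sub I).adj_sub huv) h
  have hreach : ∀ i ∈ I, G₀.Reachable (T.leaf i₀) (T.leaf i) := by
    intro i hi
    rw [← hc.leaf, ← hc.leaf]
    refine reachable_of_forall_adj c ?_ (sub_reachable T' hi₀ hi)
    intro u v huv
    by_cases h : c u = c v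
    · rw [h]
    · exact Adj.reachable ⟨h, u, v, huv, rfl, rfl⟩
  have h := T.sub_le_of_reachable G₀ hle hreach
  refine ⟨fun a ha => ?_, fun a b hab => (h.2 a b hab).2⟩
  refine mem_of_reachable {a | ∃ x ∈ (T'.sub I).verts, c x = a} ?_ (h.1 a ha)
    ⟨_, T'.leaf_mem_sub hi₀, hc.leaf i₀⟩
  rintro a b ⟨-, u, v, huv, -, hv⟩ -
  exact ⟨v, (T'.sub I).edge_vert huv.symm, hv⟩

lemma map_subRoot (hI : I.Nonempty) (r' : V') :
    c (subRoot T' r' I) = subRoot T (c r') I := by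
  have hs := T.subRoot_spec hI (c r')
  have hs' := T'.subRoot_spec hI r'
  -- In the fibre over the root of T(I), the node of T'(I) closest to r' has no parent in T'(I), so
  -- it is the root there.
  obtain ⟨x, hx, hxa⟩ := (hc.sub_lift hI).1 _ hs.1
  obtain ⟨w, ⟨hw, hwa⟩, hmin⟩ := Set.exists_min_image
    {x | x ∈ (T'.sub I).verts ∧ c x = subRoot T (c r') I} (fun x => T'.graph.dist r' x)
    (Set.toFinite _) ⟨x, hx, hxa⟩
  have hpar : ∀ u ∈ (T'.sub I).verts, ¬ T'.IsEdge r' u w := by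
    intro u hu huw
    by_cases h : c u = c w
    · have h1 := hmin u ⟨hu, h.trans hwa⟩
      have h2 := huw.2
      omega
    · have := hc.isEdge_map huw h
      rw [hwa] at this
      exact hs.2 _ ((hc.sub_map hI).1 u hu) this
  rw [← T'.eq_of_no_parent hI hw hs'.1 hpar hs'.2, hwa]

lemma prod_subEdges (hI : I.Nonempty) {r' : V'}
    {g' : T'.Edge r' → ℝ} {g : T.Edge (c r') → ℝ} (hg₁ : ∀ e, c e.1.1 = c e.1.2 → g' e = 1)
    (hg : ∀ e h, g' e = g (hc.mapEdge e h)) :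
    ∏ e ∈ T'.subEdges r' I, g' e = ∏ e ∈ T.subEdges (c r') I, g e := by
  refine hc.prod_edges ?_ ?_ hg₁ hg
  · intro e he h
    exact Finset.mem_filter.2 ⟨Finset.mem_univ _,
      (hc.sub_map hI).2 _ _ (Finset.mem_filter.1 he).2 h⟩
  · intro e he
    obtain ⟨u, v, huv, hu, hv⟩ := (hc.sub_lift hI).2 _ _ (Finset.mem_filter.1 he).2
    exact ⟨⟨(u, v), hc.exists_edge_of_adj ((T'.sub I).adj_sub huv) hu hv⟩,
      Finset.mem_filter.2 ⟨Finset.mem_univ _, huv⟩, hu, hv⟩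

/-- This avoids counting degrees inside fibres. For nonvanishing values `prod_pow_deg_mul_sq` turns
both sides into products over leaves and edges, where collapsed edges contribute y/y = 1. Both sides
are continuous, so the identity extends to values with zeros by density. -/
lemma prod_pow_deg (I : BigSet n) (x : V → ℝ) :
    (∏ v : V' with v ∈ (T'.sub I.1).verts ∧ v ∉ T'.leaf '' (I.1 : Set (Fin n)),
      x (c v) ^ (((T'.sub I.1).neighborSet v).ncard - 2)) =
    ∏ v : V with v ∈ (T.sub I.1).verts ∧ v ∉ T.leaf '' (I.1 : Set (Fin n)),
      x v ^ (((T.sub I.1).neighborSet v).ncard - 2) := by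
  have hI : I.1.Nonempty := Finset.nonempty_iff_ne_empty.2 I.ne_bot
  obtain ⟨r'⟩ := T'.isTree.connected.nonempty
  have hdense : Dense (Set.univ.pi fun _ : V => ({0}ᶜ : Set ℝ)) :=
    dense_pi _ fun _ _ => dense_compl_singleton 0
  have hcont₁ : Continuous fun x : V → ℝ =>
      ∏ v : V' with v ∈ (T'.sub I.1).verts ∧ v ∉ T'.leaf '' (I.1 : Set (Fin n)),
        x (c v) ^ (((T'.sub I.1).neighborSet v).ncard - 2) :=
    continuous_finsetProd _ fun v _ => (continuous_apply (c v)).pow _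
  have hcont₂ : Continuous fun x : V → ℝ =>
      ∏ v : V with v ∈ (T.sub I.1).verts ∧ v ∉ T.leaf '' (I.1 : Set (Fin n)),
        x v ^ (((T.sub I.1).neighborSet v).ncard - 2) :=
    continuous_finsetProd _ fun v _ => (continuous_apply v).pow _
  refine congrFun (hcont₁.ext_on hdense hcont₂ fun y hy => ?_) x
  have hy : ∀ v, y v ≠ 0 := fun v => hy v (Set.mem_univ v)
  have h₁ := LeafTree.prod_pow_deg_mul_sq (T := T') (r := r') I (y := y ∘ c) fun v => hy (c v)
  have h₂ := LeafTree.prod_pow_deg_mul_sq (T := T) (r := c r') I hy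
  have h₃ : ∏ e ∈ T'.subEdges r' I.1, ((y ∘ c) e.1.1 / (y ∘ c) e.1.2) =
      ∏ e ∈ T.subEdges (c r') I.1, (y e.1.1 / y e.1.2) := by
    refine hc.prod_subEdges hI (fun e h => ?_) fun e h => rfl
    rw [Function.comp_apply, Function.comp_apply, h, div_self (hy _)]
  simp only [Function.comp_apply, hc.leaf] at h₁ h₃
  rw [h₃, hc.map_subRoot hI, ← h₂] at h₁
  exact mul_right_cancel₀ (pow_ne_zero 2 (hy _)) h₁

/-! ### The product formula -/

theorem fμκ_fpμ_leafMarginal (hdeg : ∀ v, deg T'.graph v ≠ 1 → deg T'.graph v ≤ 3) {r' : V'}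
    (θ : ℝ × (T.Edge (c r') → Fin 2 → ℝ)) :
    fμκ T' (fpμ (leafMarginal T (jointProb T (c r') θ))) = ψ T (c r') (fθω T (c r') θ) := by
  obtain ⟨ℓ, hℓ⟩ := T.exists_meanRecursion (c r') θ
  have hmean : (fθω T (c r') θ).1 = fun v => 1 - 2 * ℓ v := by
    funext v
    rw [← LeafTree.mean_jointProb hℓ v]
    rfl
  refine Prod.ext ?_ ?_
  · funext i
    change mean (leafMarginal T (jointProb T (c r') θ)) i = (1 - (fθω T (c r') θ).1 (T.leaf i)) / 2
    rw [LeafTree.mean_leafMarginal, LeafTree.mean_jointProb hℓ, hmean]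
    ring
  · funext I
    have hI : I.1.Nonempty := Finset.nonempty_iff_ne_empty.2 I.ne_bot
    change treeCumulant T' (centralMoment (leafMarginal T (jointProb T (c r') θ))) I =
      (ψ T (c r') (fθω T (c r') θ)).2 I
    rw [← hc.leafMarginal_expand, LeafTree.treeCumulant_eq_weight (hc.meanRecursion_expand hℓ),
      LeafTree.weight_subEdges hdeg]
    simp only [Function.comp_apply]
    rw [hc.map_subRoot hI, hc.prod_pow_deg I fun v => 1 - 2 * ℓ v,
      hc.prod_subEdges hI (g := fun e => θ.2 e 1 - θ.2 e 0)]
    · simp only [ψ, hmean]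
      rfl
    · intro e h
      simp [hc.expand_of_eq θ e h]
    · intro e h
      rw [hc.expand_of_ne θ e h]

end Collapse

end TreeCumulants

/-! ### Global Markov properties and factorization on a tree. -/

namespace TreeCumulants

open SimpleGraph

open scoped Classical

set_option linter.unusedSectionVars false

section Marginals

variable {V : Type*} [Fintype V] (p : (V → Fin 2) → ℝ)

lemma margProb_congr {S : Finset V} {y y' : V → Fin 2} (h : ∀ v ∈ S, y v = y' v) :
    margProb p S y = margProb p S y' := by
  unfold margProb
  refine Finset.sum_congr (Finset.filter_congr fun z _ => ?_) fun _ _ => rfl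
  exact forall_congr' fun v => forall_congr' fun hv => by rw [h v hv]

lemma margProb_univ (y : V → Fin 2) : margProb p Finset.univ y = p y := by
  unfold margProb
  rw [Finset.sum_eq_single_of_mem y (by simp)]
  intro z hz hne
  exact absurd (funext fun v => (Finset.mem_filter.1 hz).2 v (Finset.mem_univ v)) hne

lemma margProb_split {S : Finset V} {v : V} (hv : v ∉ S) (y : V → Fin 2) :
    margProb p S y = margProb p (insert v S) (Function.update y v 0) +
      margProb p (insert v S) (Function.update y v 1) := by
  have key : ∀ (a : Fin 2) (z : V → Fin 2),
      (∀ w ∈ insert v S, z w = Function.update y v a w) ↔ (∀ w ∈ S, z w = y w) ∧ z v = a := by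
    intro a z
    rw [Finset.forall_mem_insert, Function.update_self, and_comm]
    refine and_congr_left fun _ => forall_congr' fun w => forall_congr' fun hw => ?_
    rw [Function.update_of_ne]
    rintro rfl
    exact hv hw
  unfold margProb
  simp_rw [key]
  rw [← Finset.sum_filter_add_sum_filter_not _ (fun z : V → Fin 2 => z v = 0),
    Finset.filter_filter, Finset.filter_filter]
  congr 2
  refine Finset.filter_congr fun z _ => and_congr_right fun _ => ?_
  generalize z v = a
  fin_cases a <;> simp

variable {p} in
lemma margProb_nonneg (hp : ∀ y, 0 ≤ p y) (S : Finset V) (y : V → Fin 2) : 0 ≤ margProb p S y :=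
  Finset.sum_nonneg fun _ _ => hp _

variable {p} in
lemma margProb_mono (hp : ∀ y, 0 ≤ p y) {S S' : Finset V} (h : S ⊆ S') (y : V → Fin 2) :
    margProb p S' y ≤ margProb p S y := by
  unfold margProb
  refine Finset.sum_le_sum_of_subset_of_nonneg ?_ fun _ _ _ => hp _
  intro z hz
  rw [Finset.mem_filter] at hz ⊢
  exact ⟨hz.1, fun v hv => hz.2 v (h hv)⟩

variable {p} in
-- If the conditioning event is null both sides are zero, so the value of the quotient does not
-- matter.
lemma margProb_insert (hp : ∀ y, 0 ≤ p y) {S : Finset V} {v : V} (hv : v ∉ S) (y : V → Fin 2) :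
    margProb p (insert v S) y =
      bern (margProb p (insert v S) (Function.update y v 1) / margProb p S y) (y v) *
        margProb p S y := by
  by_cases h0 : margProb p S y = 0
  · rw [h0, mul_zero]
    refine le_antisymm ?_ (margProb_nonneg hp _ _)
    rw [← h0]
    exact margProb_mono hp (Finset.subset_insert _ _) y
  · have hs := margProb_split p hv y
    have hy : y = Function.update y v (y v) := (Function.update_eq_self v y).symm
    obtain h1 | h1 : y v = 1 ∨ y v = 0 := by
      generalize y v = a
      fin_cases a <;> simp
    · rw [h1, bern, if_pos rfl, div_mul_cancel₀ _ h0]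
      conv_lhs => rw [hy, h1]
    · rw [h1, bern, if_neg (by simp), sub_mul, div_mul_cancel₀ _ h0, one_mul]
      conv_lhs => rw [hy, h1]
      linarith

variable {p} in
-- Exchanging the coordinates in A' between two configurations that agree on C is an involution. It
-- matches the terms of the two products of marginals, because f depends only on A' ∪ C and g only
-- on the complement of A'.
lemma condIndep_of_factorization {A B C : Finset V} (A' : Set V) (hA : ∀ v ∈ A, v ∈ A')
    (hB : ∀ v ∈ B, v ∉ A') (hC : ∀ v ∈ C, v ∉ A') (f g : (V → Fin 2) → ℝ)
    (hf : ∀ y y', (∀ v, v ∈ A' ∨ v ∈ C → y v = y' v) → f y = f y')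
    (hg : ∀ y y', (∀ v ∉ A', y v = y' v) → g y = g y') (hp : ∀ y, p y = f y * g y) :
    CondIndep p A B C := by
  intro y
  set mix : (V → Fin 2) → (V → Fin 2) → V → Fin 2 := fun z z' v => if v ∈ A' then z v else z' v
    with hmix
  have hin : ∀ z z' v, v ∈ A' → mix z z' v = z v := fun z z' v h => if_pos h
  have hout : ∀ z z' v, v ∉ A' → mix z z' v = z' v := fun z z' v h => if_neg h
  have hmm : ∀ z z', mix (mix z z') (mix z' z) = z := by
    intro z z'
    funext v
    by_cases h : v ∈ A'
    · rw [hin _ _ _ h, hin _ _ _ h]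
    · rw [hout _ _ _ h, hout _ _ _ h]
  unfold margProb
  rw [Finset.sum_mul_sum, Finset.sum_mul_sum, ← Finset.sum_product', ← Finset.sum_product']
  refine Finset.sum_bij' (fun z _ => (mix z.1 z.2, mix z.2 z.1))
    (fun z _ => (mix z.1 z.2, mix z.2 z.1)) ?_ ?_ ?_ ?_ ?_
  · rintro ⟨z, z'⟩ h
    simp only [Finset.mem_product, Finset.mem_filter, Finset.mem_univ, true_and,
      Finset.mem_union] at h ⊢
    refine ⟨fun v hv => ?_, fun v hv => ?_⟩
    · rcases hv with hv | hv
      · rw [hin _ _ _ (hA v hv), h.1 v (Or.inl (Or.inl hv))]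
      · rw [hout _ _ _ (hC v hv), h.2 v hv]
    · rcases hv with hv | hv
      · rw [hout _ _ _ (hB v hv), h.1 v (Or.inl (Or.inr hv))]
      · rw [hout _ _ _ (hC v hv), h.1 v (Or.inr hv)]
  · rintro ⟨z, z'⟩ h
    simp only [Finset.mem_product, Finset.mem_filter, Finset.mem_univ, true_and,
      Finset.mem_union] at h ⊢
    refine ⟨fun v hv => ?_, fun v hv => ?_⟩
    · rcases hv with (hv | hv) | hv
      · rw [hin _ _ _ (hA v hv), h.1 v (Or.inl hv)]
      · rw [hout _ _ _ (hB v hv), h.2 v (Or.inl hv)]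
      · rw [hout _ _ _ (hC v hv), h.2 v (Or.inr hv)]
    · rw [hout _ _ _ (hC v hv), h.1 v (Or.inr hv)]
  · rintro ⟨z, z'⟩ _
    exact Prod.ext (hmm z z') (hmm z' z)
  · rintro ⟨z, z'⟩ _
    exact Prod.ext (hmm z z') (hmm z' z)
  · rintro ⟨z, z'⟩ h
    simp only [Finset.mem_product, Finset.mem_filter, Finset.mem_univ, true_and,
      Finset.mem_union] at h
    have hzC : ∀ v ∈ C, z v = z' v := fun v hv => (h.1 v (Or.inr hv)).trans (h.2 v hv).symm
    have h1 : f (mix z z') = f z := by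
      refine hf _ _ fun v hv => ?_
      rcases hv with hv | hv
      · exact hin _ _ _ hv
      · rw [hout _ _ _ (hC v hv), hzC v hv]
    have h2 : f (mix z' z) = f z' := by
      refine hf _ _ fun v hv => ?_
      rcases hv with hv | hv
      · exact hin _ _ _ hv
      · rw [hout _ _ _ (hC v hv), hzC v hv]
    have h3 : g (mix z z') = g z' := hg _ _ fun v hv => hout _ _ _ hv
    have h4 : g (mix z' z) = g z := hg _ _ fun v hv => hout _ _ _ hv
    simp only [hp, h1, h2, h3, h4]
    ring

end Marginals

namespace LeafTree

variable {n : ℕ} {V : Type*} [Fintype V] (T : LeafTree n V) (r : V)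

lemma bern_nonneg {t : ℝ} (ht : t ∈ Set.Icc 0 1) (a : Fin 2) : 0 ≤ bern t a := by
  unfold bern
  split_ifs
  · exact ht.1
  · linarith [ht.2]

variable {T r} in
lemma jointProb_mem_stdSimplex {θ : ℝ × (T.Edge r → Fin 2 → ℝ)} (hθ : θ ∈ Theta T r) :
    jointProb T r θ ∈ stdSimplex ℝ (V → Fin 2) :=
  ⟨fun _ => mul_nonneg (bern_nonneg hθ.1 _)
    (Finset.prod_nonneg fun e _ => bern_nonneg (hθ.2 e _) _), sum_jointProb θ⟩

variable {T r} in
-- A' is the union of the components that meet A after removal of C. An edge touching A' has both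
-- ends in A' ∪ C, so the edge factors split as `condIndep_of_factorization` requires.
lemma condIndep_jointProb (θ : ℝ × (T.Edge r → Fin 2 → ℝ)) {A B C : Finset V}
    (hAC : Disjoint A C) (hsep : Separates T.graph A B C) : CondIndep (jointProb T r θ) A B C := by
  let G₀ : SimpleGraph V :=
    { Adj := fun u v => T.graph.Adj u v ∧ u ∉ C ∧ v ∉ C
      symm := ⟨fun _ _ h => ⟨h.1.symm, h.2.2, h.2.1⟩⟩
      loopless := ⟨fun _ h => h.1.ne rfl⟩ }
  have hle : G₀ ≤ T.graph := fun _ _ h => h.1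
  have hnotC : ∀ a ∈ A, ∀ x, G₀.Reachable a x → x ∉ C := fun a ha x hx =>
    mem_of_reachable (G := G₀) {x | x ∉ C} (fun _ _ h _ => h.2.2) hx
      (Finset.disjoint_left.1 hAC ha)
  set A' : Set V := {x | ∃ a ∈ A, G₀.Reachable a x} with hA'
  have hC : ∀ v ∈ C, v ∉ A' := by
    rintro v hv ⟨a, ha, h⟩
    exact hnotC a ha v h hv
  have hstep : ∀ u v, T.graph.Adj u v → u ∈ A' → v ∈ A' ∨ v ∈ C := by
    rintro u v huv ⟨a, ha, h⟩
    by_cases hv : v ∈ C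
    · exact Or.inr hv
    · exact Or.inl ⟨a, ha, h.trans (Adj.reachable ⟨huv, hnotC a ha u h, hv⟩)⟩
  refine condIndep_of_factorization A' (fun v hv => ⟨v, hv, Reachable.refl v⟩) ?_ hC
    (fun y => (if r ∈ A' then bern θ.1 (y r) else 1) *
      ∏ e : T.Edge r with e.1.1 ∈ A' ∨ e.1.2 ∈ A', bern (θ.2 e (y e.1.1)) (y e.1.2))
    (fun y => (if r ∈ A' then 1 else bern θ.1 (y r)) *
      ∏ e : T.Edge r with ¬ (e.1.1 ∈ A' ∨ e.1.2 ∈ A'), bern (θ.2 e (y e.1.1)) (y e.1.2)) ?_ ?_ ?_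
  · rintro b hb ⟨a, ha, ⟨w⟩⟩
    obtain ⟨c, hc, hcw⟩ := hsep a ha b hb (w.mapLe hle)
    rw [Walk.support_mapLe_eq_support] at hcw
    exact hnotC a ha c ⟨w.takeUntil c hcw⟩ hc
  · intro y y' h
    congr 1
    · split_ifs with hr
      · rw [h r (Or.inl hr)]
      · rfl
    · refine Finset.prod_congr rfl fun e he => ?_
      have he := (Finset.mem_filter.1 he).2
      have h1 : e.1.1 ∈ A' ∨ e.1.1 ∈ C := he.elim Or.inl (hstep _ _ e.2.1.symm)
      have h2 : e.1.2 ∈ A' ∨ e.1.2 ∈ C := he.elim (hstep _ _ e.2.1) Or.inl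
      rw [h _ h1, h _ h2]
  · intro y y' h
    congr 1
    · split_ifs with hr
      · rfl
      · rw [h r hr]
    · refine Finset.prod_congr rfl fun e he => ?_
      have he := not_or.1 (Finset.mem_filter.1 he).2
      rw [h _ he.1, h _ he.2]
  · intro y
    unfold jointProb
    rw [← Finset.prod_filter_mul_prod_filter_not Finset.univ
      (fun e : T.Edge r => e.1.1 ∈ A' ∨ e.1.2 ∈ A')]
    split_ifs <;> ring

variable {T r} in
lemma reachable_root {S : Finset V} (hS : ∀ e : T.Edge r, e.1.2 ∈ S → e.1.1 ∈ S)
    {G₀ : SimpleGraph V} (hG₀ : ∀ u v, T.graph.Adj u v → u ∈ S → v ∈ S → G₀.Adj u v) (x : V)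
    (hx : x ∈ S) : G₀.Reachable r x := by
  induction hk : T.graph.dist r x using Nat.strong_induction_on generalizing x with
  | _ k ih =>
    by_cases hxr : x = r
    · rw [hxr]
    · obtain ⟨u, hu⟩ := T.exists_isEdge hxr
      have huS := hS ⟨(u, x), hu⟩ hx
      have := hu.2
      exact (ih _ (by omega) u huS rfl).trans (hG₀ u x hu.1 huS hx).reachable

variable {T r} in
-- A set closed under parents is connected through the root without using uv. A walk from v to S
-- avoiding u would also avoid uv and thus bypass a bridge.
lemma separates_parent {S : Finset V}
    (hS : ∀ e : T.Edge r, e.1.2 ∈ S → e.1.1 ∈ S) {u v : V} (huv : T.IsEdge r u v) (hu : u ∈ S)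
    (hv : v ∉ S) : Separates T.graph {v} (S.erase u) {u} := by
  intro a ha b hb w
  obtain rfl := Finset.mem_singleton.1 ha
  refine ⟨u, Finset.mem_singleton_self u, ?_⟩
  by_contra hn
  have hG : ∀ x y, T.graph.Adj x y → x ∈ S → y ∈ S →
      (T.graph.deleteEdges {s(u, a)}).Adj x y := by
    intro x y hxy hx hy
    rw [deleteEdges_adj]
    refine ⟨hxy, fun he => ?_⟩
    rw [Set.mem_singleton_iff, Sym2.eq_iff] at he
    rcases he with ⟨_, rfl⟩ | ⟨rfl, _⟩
    · exact hv hy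
    · exact hv hx
  have h1 : (T.graph.deleteEdges {s(u, a)}).Reachable a b := by
    refine ⟨w.toDeleteEdges _ fun e he hev => hn ?_⟩
    rw [Set.mem_singleton_iff] at hev
    subst hev
    exact Walk.fst_mem_support_of_mem_edges _ he
  have h2 := reachable_root hS hG b (Finset.mem_of_mem_erase hb)
  have h3 := reachable_root hS hG u hu
  exact isBridge_iff.1 (isAcyclic_iff_forall_adj_isBridge.1 T.isTree.isAcyclic huv.1)
    ((h3.symm.trans h2).trans h1.symm)

/-- The root and edge parameters of a mass function: the conditional probabilities along the
edges of the rooted tree. -/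
noncomputable def condParams (p : (V → Fin 2) → ℝ) : ℝ × (T.Edge r → Fin 2 → ℝ) :=
  (margProb p {r} (fun _ => 1), fun e a =>
    margProb p {e.1.2, e.1.1} (Function.update (fun _ => a) e.1.2 1) /
      margProb p {e.1.1} (fun _ => a))

/-- For a null conditioning event the quotient is 0 by convention, which still lies in [0,1]. -/
lemma condParams_mem_Theta {p : (V → Fin 2) → ℝ} (hp : p ∈ stdSimplex ℝ (V → Fin 2)) :
    condParams T r p ∈ Theta T r := by
  refine ⟨⟨margProb_nonneg hp.1 _ _, ?_⟩, fun e a => ⟨?_, ?_⟩⟩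
  · rw [← hp.2]
    exact Finset.sum_le_sum_of_subset_of_nonneg (Finset.filter_subset _ _) fun _ _ _ => hp.1 _
  · exact div_nonneg (margProb_nonneg hp.1 _ _) (margProb_nonneg hp.1 _ _)
  · refine div_le_one_of_le₀ ?_ (margProb_nonneg hp.1 _ _)
    refine (margProb_mono hp.1 (Finset.subset_insert _ _) _).trans (le_of_eq ?_)
    refine margProb_congr p fun v hv => ?_
    rw [Finset.mem_singleton.1 hv, Function.update_of_ne e.2.1.ne]

variable {T} in
-- Nodes are added in order of distance from the root, so the set S stays closed under parents. A
-- new node is then independent of the rest of S given its parent, which yields one more edge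
-- factor.
theorem jointProb_condParams {p : (V → Fin 2) → ℝ} (hp : p ∈ markovModel T.graph) :
    jointProb T r (condParams T r p) = p := by
  obtain ⟨hsimp, hmarkov⟩ := hp
  have hone : ∀ y, margProb p ∅ y = 1 := by
    intro y
    rw [← hsimp.2]
    unfold margProb
    simp
  have key : ∀ S : Finset V, r ∈ S → (∀ e : T.Edge r, e.1.2 ∈ S → e.1.1 ∈ S) → ∀ y,
      margProb p S y = bern (condParams T r p).1 (y r) *
        ∏ e : T.Edge r with e.1.2 ∈ S, bern ((condParams T r p).2 e (y e.1.1)) (y e.1.2) := by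
    intro S
    induction S using Finset.induction_on_max_value (fun v => T.graph.dist r v) with
    | empty => exact fun h => absurd h (Finset.notMem_empty r)
    | insert a s ha hmax ih =>
      intro hr hS y
      by_cases har : a = r
      · subst har
        -- The newest node is at maximal distance; if it is the root, that distance is 0 and no
        -- other node is present.
        have hs : s = ∅ := by
          rw [Finset.eq_empty_iff_forall_notMem]
          intro x hx
          have h1 := hmax x hx
          rw [dist_self, Nat.le_zero, T.isTree.connected.dist_eq_zero_iff] at h1
          exact ha (h1 ▸ hx)
        subst hs
        rw [margProb_insert hsimp.1 ha, hone, div_one, mul_one, Finset.prod_eq_one, mul_one]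
        · congr 1
          refine margProb_congr p fun v hv => ?_
          have hv : v = a := by simpa using hv
          rw [hv, Function.update_self]
        · intro e he
          have h1 : e.1.2 = a := by simpa using (Finset.mem_filter.1 he).2
          have h2 := e.2
          rw [h1] at h2
          exact absurd h2 T.not_isEdge_root
      · have hrs : r ∈ s := (Finset.mem_insert.1 hr).resolve_left fun h => har h.symm
        have hSs : ∀ e : T.Edge r, e.1.2 ∈ s → e.1.1 ∈ s := by
          intro e he
          refine (Finset.mem_insert.1 (hS e (Finset.mem_insert_of_mem he))).resolve_left ?_
          intro h
          have h1 := hmax _ he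
          have h2 := e.2.2
          rw [h] at h2
          omega
        obtain ⟨u, hu⟩ := T.exists_isEdge har
        have hus : u ∈ s := (Finset.mem_insert.1 (hS ⟨(u, a), hu⟩
          (Finset.mem_insert_self a s))).resolve_left hu.1.ne
        have hfilter : (Finset.univ.filter fun e : T.Edge r => e.1.2 ∈ insert a s) =
            insert ⟨(u, a), hu⟩ (Finset.univ.filter fun e : T.Edge r => e.1.2 ∈ s) := by
          ext e
          simp only [Finset.mem_filter, Finset.mem_univ, true_and, Finset.mem_insert]
          refine or_congr_left ⟨fun h => ?_, fun h => by rw [h]⟩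
          exact Edge.ext_snd (e' := ⟨(u, a), hu⟩) h
        have hau : a ∉ ({u} : Finset V) := by
          rw [Finset.mem_singleton]
          exact hu.1.ne.symm
        have hci := hmarkov {a} (s.erase u) {u}
          (Finset.disjoint_singleton_left.2 fun h => ha (Finset.mem_of_mem_erase h))
          (Finset.disjoint_singleton_left.2 hau)
          (Finset.disjoint_singleton_right.2 (Finset.notMem_erase u s))
          (separates_parent hSs hu hus ha) y
        have hU1 : {a} ∪ s.erase u ∪ {u} = insert a s := by
          rw [Finset.union_assoc, Finset.union_comm (s.erase u), ← Finset.insert_eq u,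
            Finset.insert_erase hus, ← Finset.insert_eq]
        have hU2 : s.erase u ∪ {u} = s := by
          rw [Finset.union_comm, ← Finset.insert_eq, Finset.insert_erase hus]
        rw [hU1, hU2, ← Finset.insert_eq, margProb_insert hsimp.1 hau] at hci
        have hθ : (condParams T r p).2 ⟨(u, a), hu⟩ (y u) =
            margProb p (insert a {u}) (Function.update y a 1) / margProb p {u} y := by
          change margProb p {a, u} (Function.update (fun _ => y u) a 1) /
            margProb p {u} (fun _ => y u) = _
          congr 1
          · refine margProb_congr p fun v hv => ?_
            by_cases hva : v = a
            · rw [hva, Function.update_self, Function.update_self]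
            · rw [Function.update_of_ne hva, Function.update_of_ne hva]
              have : v = u := by simpa [hva] using hv
              rw [this]
          · refine margProb_congr p fun v hv => ?_
            rw [Finset.mem_singleton.1 hv]
        rw [hfilter, Finset.prod_insert (by simpa using ha)]
        dsimp only
        rw [hθ, mul_left_comm, ← ih hrs hSs y]
        -- If the value of the parent has probability zero, both sides vanish; otherwise this
        -- probability can be cancelled from the independence relation.
        by_cases h0 : margProb p {u} y = 0
        · have h1 : margProb p s y = 0 := by
            refine le_antisymm ?_ (margProb_nonneg hsimp.1 _ _)
            rw [← h0]
            exact margProb_mono hsimp.1 (Finset.singleton_subset_iff.2 hus) y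
          rw [h1, mul_zero]
          refine le_antisymm ?_ (margProb_nonneg hsimp.1 _ _)
          rw [← h1]
          exact margProb_mono hsimp.1 (Finset.subset_insert _ _) y
        · refine mul_right_cancel₀ h0 ?_
          rw [hci]
          ring
  funext y
  rw [← margProb_univ p y, key Finset.univ (Finset.mem_univ r) (fun _ _ => Finset.mem_univ _) y]
  unfold jointProb
  simp

/-- On a tree, the global Markov properties characterize the Markov processes. -/
theorem markovModel_eq : markovModel T.graph = jointProb T r '' Theta T r := by
  ext p
  constructor
  · intro hp
    exact ⟨condParams T r p, condParams_mem_Theta T r hp.1, jointProb_condParams r hp⟩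
  · rintro ⟨θ, hθ, rfl⟩
    exact ⟨jointProb_mem_stdSimplex hθ, fun A B C _ hAC _ hsep => condIndep_jointProb θ hAC hsep⟩

lemma leafMarginal_mem_stdSimplex {p : (V → Fin 2) → ℝ} (hp : p ∈ stdSimplex ℝ (V → Fin 2)) :
    leafMarginal T p ∈ stdSimplex ℝ (Fin n → Fin 2) := by
  refine ⟨fun x => Finset.sum_nonneg fun _ _ => hp.1 _, ?_⟩
  have h := sum_leafMarginal_mul (T := T) p fun _ => 1
  simp only [mul_one] at h
  rw [h, hp.2]

end LeafTree

end TreeCumulants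

/-! ### The image of the model in the coordinates of the expansion. -/

theorem lemma4p2 {n : ℕ} {V V' : Type*} [Fintype V] [Fintype V']
    (T : TreeCumulants.LeafTree n V) (r : V) (T' : TreeCumulants.LeafTree n V')
    (_ : TreeCumulants.TrivalentExpansion T T') :
    (TreeCumulants.fμκ T' ∘ TreeCumulants.fpμ) '' TreeCumulants.model T ⊆
        TreeCumulants.cumulantSpace T' ∧
      (TreeCumulants.fμκ T' ∘ TreeCumulants.fpμ) '' TreeCumulants.model T =
        TreeCumulants.ψ T r '' TreeCumulants.Omega T r := by
  rename_i X
  refine ⟨?_, ?_⟩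
  · rw [Set.image_comp]
    refine Set.image_mono (Set.image_mono ?_)
    rintro _ ⟨p, hp, rfl⟩
    exact T.leafMarginal_mem_stdSimplex hp.1
  · obtain ⟨c, hc⟩ := X.exists_collapse
    -- Any node of `T'` above r serves as its root, so r may be arbitrary.
    obtain ⟨r', rfl⟩ := hc.surj r
    rw [TreeCumulants.model, T.markovModel_eq (c r'), TreeCumulants.Omega, Set.image_image,
      Set.image_image, Set.image_image]
    refine Set.image_congr fun θ _ => ?_
    exact hc.fμκ_fpμ_leafMarginal X.deg_le_three θ
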